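/- Let $K$ be an algebraically closed field, let $Q$ be a finite connected quiver in which at most two arrows start and at most two arrows end at each vertex, and let $\Lambda = KQ/I$, where $I$ is an admissible ideal of the path algebra $KQ$ (that is, a two-sided ideal with $R^m \subseteq I \subseteq R^2$ for some $m \ge 2$, where $R$ is the ideal generated by the arrows). Assume that $\Lambda$ is - tame (algebras of finite representation type included); - symmetric, i.e. there is a nondegenerate symmetric $K$-bilinear form $(-,-)$ on $\Lambda$ with $(xy,z)=(x,yz)$ for all $x,y,z\in\Lambda$; - periodic of period four, i.e. $4$ is the smallest integer $d\ge 1$ such that $\Omega^d_{\Lambda^e}(\Lambda)\cong\Lambda$ as $\Lambda$-bimodules, where $\Lambda^e=\Lambda\otimes_K\Lambda^{\mathrm{op}}$ and the syzygy $\Omega(M)$ is the kernel of a projective cover of $M$. For a vertex $i$ of $Q$, let $i^+$ be the set of arrows starting at $i$ and $i^-$ the set of arrows ending at $i$. If $\Lambda$ has infinite representation type, i.e. there are infinitely many isomorphism classes of finitely generated indecomposable right $\Lambda$-modules, then there is no arrow $\alpha: i\to j$ of $Q$ with $i^+=\{\alpha\}=j^-$. -/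

import Mathlib

open scoped TensorProduct

universe u v w

/-! ### Path algebras and admissible ideals -/

/-- The underlying space of the path algebra `KQ` of a quiver `Q` with finite vertex set `V`: the
`K`-vector space with basis all paths of `Q` (the trivial ones included), written as the direct sum
over `a b : V` of the spaces with basis the paths from `a` to `b`. -/
def PathAlgebra (K : Type u) (V : Type v) [Quiver.{w} V] [Field K] : Type (max u v w) :=
  (a b : V) → (Quiver.Path a b →₀ K)

namespace PathAlgebra

variable {K : Type u} {V : Type v} [Quiver.{w} V] [Field K]

noncomputable instance : AddCommGroup (PathAlgebra K V) :=
  inferInstanceAs (AddCommGroup ((a b : V) → (Quiver.Path a b →₀ K)))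

noncomputable instance : Module K (PathAlgebra K V) :=
  inferInstanceAs (Module K ((a b : V) → (Quiver.Path a b →₀ K)))

/-- Bilinear extension of the concatenation of paths: first the left path, then the right one. -/
noncomputable def concat (K : Type u) {V : Type v} [Quiver.{w} V] [Field K] (a b c : V) :
    (Quiver.Path a b →₀ K) →ₗ[K] (Quiver.Path b c →₀ K) →ₗ[K] (Quiver.Path a c →₀ K) :=
  Finsupp.lift _ K _ fun p => Finsupp.lmapDomain K K fun q => p.comp q

theorem concat_single (a b c : V) (p : Quiver.Path a b) (q : Quiver.Path b c) (r s : K) :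
    concat K a b c (Finsupp.single p r) (Finsupp.single q s) =
      Finsupp.single (p.comp q) (r * s) := by
  simp [concat, Finsupp.mapDomain_single]

theorem concat_assoc (a b c d : V) (x : Quiver.Path a b →₀ K) (y : Quiver.Path b c →₀ K)
    (z : Quiver.Path c d →₀ K) :
    concat K a c d (concat K a b c x y) z = concat K a b d x (concat K b c d y z) := by
  induction x using Finsupp.induction_linear with
  | zero => simp
  | add x₁ x₂ h₁ h₂ => simp [h₁, h₂]
  | single p r =>
    induction y using Finsupp.induction_linear with
    | zero => simp
    | add y₁ y₂ h₁ h₂ => simp [h₁, h₂]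
    | single q s =>
      induction z using Finsupp.induction_linear with
      | zero => simp
      | add z₁ z₂ h₁ h₂ => simp [h₁, h₂]
      | single t k =>
        rw [concat_single, concat_single, concat_single, concat_single, mul_assoc,
          Quiver.Path.comp_assoc]

theorem nil_concat (a b : V) (x : Quiver.Path a b →₀ K) :
    concat K a a b (Finsupp.single Quiver.Path.nil 1) x = x := by
  induction x using Finsupp.induction_linear with
  | zero => simp
  | add x₁ x₂ h₁ h₂ => simp [h₁, h₂]
  | single p r => simp [concat_single]

theorem concat_nil (a b : V) (x : Quiver.Path a b →₀ K) :
    concat K a b b x (Finsupp.single Quiver.Path.nil 1) = x := by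
  induction x using Finsupp.induction_linear with
  | zero => simp
  | add x₁ x₂ h₁ h₂ => simp [h₁, h₂]
  | single p r => simp [concat_single]

theorem add_apply (x y : PathAlgebra K V) (a b : V) : (x + y) a b = x a b + y a b := rfl

theorem zero_apply (a b : V) : (0 : PathAlgebra K V) a b = 0 := rfl

theorem smul_apply (r : K) (x : PathAlgebra K V) (a b : V) : (r • x) a b = r • x a b := rfl

section Ring

variable [Fintype V] [DecidableEq V]


/-- Multiplication: concatenation of composable paths, all other products of paths being zero. -/
noncomputable instance : Mul (PathAlgebra K V) :=
  ⟨fun x y a c => ∑ b, concat K a b c (x a b) (y b c)⟩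

/-- The unit: the sum of all trivial paths. -/
noncomputable instance : One (PathAlgebra K V) :=
  ⟨fun a => Pi.single a (Finsupp.single Quiver.Path.nil 1)⟩

theorem mul_apply (x y : PathAlgebra K V) (a c : V) :
    (x * y) a c = ∑ b, concat K a b c (x a b) (y b c) := rfl

theorem one_apply_self (a : V) :
    (1 : PathAlgebra K V) a a = Finsupp.single Quiver.Path.nil 1 :=
  Pi.single_eq_same (M := fun b => Quiver.Path a b →₀ K) a _

theorem one_apply_ne {a b : V} (h : b ≠ a) : (1 : PathAlgebra K V) a b = 0 :=
  Pi.single_eq_of_ne (M := fun b => Quiver.Path a b →₀ K) h _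

noncomputable instance : Ring (PathAlgebra K V) :=
  { (inferInstance : AddCommGroup (PathAlgebra K V)) with
    mul := (· * ·)
    one := 1
    left_distrib := fun x y z => by
      funext a c
      simp [mul_apply, add_apply, Finset.sum_add_distrib]
    right_distrib := fun x y z => by
      funext a c
      simp [mul_apply, add_apply, Finset.sum_add_distrib]
    zero_mul := fun x => by
      funext a c
      simp [mul_apply, zero_apply]
    mul_zero := fun x => by
      funext a c
      simp [mul_apply, zero_apply]
    mul_assoc := fun x y z => by
      funext a d
      simp only [mul_apply, map_sum, LinearMap.sum_apply, concat_assoc]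
      exact Finset.sum_comm
    one_mul := fun x => by
      funext a c
      rw [mul_apply, Finset.sum_eq_single a]
      · rw [one_apply_self, nil_concat]
      · intro b _ hb
        simp [one_apply_ne hb]
      · simp
    mul_one := fun x => by
      funext a c
      rw [mul_apply, Finset.sum_eq_single c]
      · rw [one_apply_self, concat_nil]
      · intro b _ hb
        simp [one_apply_ne hb.symm]
      · simp }

noncomputable instance : Algebra K (PathAlgebra K V) :=
  Algebra.ofModule
    (fun r x y => by
      funext a c
      simp [mul_apply, smul_apply, Finset.smul_sum])
    (fun r x y => by
      funext a c
      simp [mul_apply, smul_apply, Finset.smul_sum])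

/-- The `m`-th power of the arrow ideal of `KQ`: the linear combinations of paths of length at
least `m`. -/
def arrowIdealPow (K : Type u) (V : Type v) [Quiver.{w} V] [Field K] (m : ℕ) :
    Set (PathAlgebra K V) :=
  {x | ∀ (a b : V), ∀ p ∈ (x a b).support, m ≤ p.length}

/-- A two-sided ideal `I` of `KQ` is admissible if `R ^ m ⊆ I ⊆ R ^ 2` for some `m ≥ 2`, where `R`
is the arrow ideal. -/
def IsAdmissible (I : Ideal (PathAlgebra K V)) : Prop :=
  (I : Set (PathAlgebra K V)) ⊆ arrowIdealPow K V 2 ∧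
    ∃ m : ℕ, 2 ≤ m ∧ arrowIdealPow K V m ⊆ (I : Set (PathAlgebra K V))

end Ring

end PathAlgebra

/-! ### Modules: indecomposability, syzygies, periods -/

/-- Nonzero, and not the internal direct sum of two nonzero submodules. -/
def IsIndecomposableModule (R : Type u) [Ring R] (M : Type v) [AddCommGroup M] [Module R M] :
    Prop :=
  Nontrivial M ∧ ∀ U W : Submodule R M, IsCompl U W → U = ⊥ ∨ W = ⊥

/-- `π : P → M` is a projective cover: `P` is projective and `π` is an epimorphism whose kernel is
superfluous. -/
def IsProjectiveCover {R : Type u} [Ring R] {P M : Type v} [AddCommGroup P] [Module R P]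
    [AddCommGroup M] [Module R M] (π : P →ₗ[R] M) : Prop :=
  Module.Projective R P ∧ Function.Surjective π ∧
    ∀ U : Submodule R P, U ⊔ LinearMap.ker π = ⊤ → U = ⊤

/-- `N ≅ Ω(M)`: `N` is isomorphic to the kernel of a finitely generated projective cover of `M`. -/
def IsSyzygy {R : Type u} [Ring R] (M N : ModuleCat.{u} R) : Prop :=
  ∃ (P : ModuleCat.{u} R) (π : P →ₗ[R] M),
    Module.Finite R P ∧ IsProjectiveCover π ∧ Nonempty (N ≃ₗ[R] LinearMap.ker π)

/-- `N ≅ Ω ^ d (M)`. -/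
def IsIteratedSyzygy {R : Type u} [Ring R] (M : ModuleCat.{u} R) : ℕ → ModuleCat.{u} R → Prop
  | 0, N => Nonempty (N ≃ₗ[R] M)
  | d + 1, N => ∃ L : ModuleCat.{u} R, IsIteratedSyzygy M d L ∧ IsSyzygy L N

/-- `M` is periodic of period `d`: `d` is the smallest positive integer with `Ω ^ d (M) ≅ M`. -/
def HasPeriod {R : Type u} [Ring R] (M : ModuleCat.{u} R) (d : ℕ) : Prop :=
  IsLeast {e : ℕ | 1 ≤ e ∧ IsIteratedSyzygy M e M} d

/-- `A` as a bimodule over itself, i.e. as a module over the enveloping algebra `A ⊗ Aᵐᵒᵖ`, with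
`(a ⊗ b) • x = a * x * b`. -/
noncomputable def regularBimodule (K : Type v) (A : Type u) [Field K] [Ring A] [Algebra K A] :
    ModuleCat.{u} (A ⊗[K] Aᵐᵒᵖ) :=
  letI : Module (A ⊗[K] Aᵐᵒᵖ) A := instModuleTensorProductMop K A
  ModuleCat.of (A ⊗[K] Aᵐᵒᵖ) A

/-- `A` is a periodic algebra of period `d`: it has period `d` as a bimodule over itself. -/
def IsPeriodicAlgebra (K : Type v) (A : Type u) [Field K] [Ring A] [Algebra K A] (d : ℕ) : Prop :=
  HasPeriod (regularBimodule K A) d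

/-! ### Symmetric algebras and representation type

Right `A`-modules are modules over `Aᵐᵒᵖ`. -/

/-- `A` carries a nondegenerate symmetric associative `K`-bilinear form. -/
def IsSymmetricAlgebraOver (K : Type v) (A : Type u) [Field K] [Ring A] [Algebra K A] : Prop :=
  ∃ B : LinearMap.BilinForm K A, B.Nondegenerate ∧ (∀ x y, B x y = B y x) ∧
    ∀ x y z, B (x * y) z = B x (y * z)

/-- `A` has finite representation type: up to isomorphism there are only finitely many finitely
generated indecomposable right `A`-modules. -/
def IsFiniteRepType (A : Type u) [Ring A] : Prop :=
  ∃ (n : ℕ) (E : Fin n → ModuleCat.{u} Aᵐᵒᵖ), ∀ M : ModuleCat.{u} Aᵐᵒᵖ,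
    Module.Finite Aᵐᵒᵖ M → IsIndecomposableModule Aᵐᵒᵖ M →
      ∃ k, Nonempty (M ≃ₗ[Aᵐᵒᵖ] E k)

/-- The finite-dimensional algebra `A` is tame (algebras of finite type included): for every `d`
there are finitely many `K[X]`-`A`-bimodules `F k`, free of rank `d` over `K[X]`, such that up to
isomorphism all but finitely many indecomposable right `A`-modules of dimension `d` have the form
`K[X]/(X - t) ⊗ F k`. Such a bimodule is given by the matrices over `K[X]` by which the elements of
`A` act on a basis, and tensoring with `K[X]/(X - t)` amounts to evaluating them at `t`. -/
def IsTame (K : Type v) (A : Type u) [Field K] [Ring A] [Algebra K A] : Prop :=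
  ∀ d : ℕ, ∃ (n : ℕ) (F : Fin n → (Aᵐᵒᵖ →ₐ[K] Matrix (Fin d) (Fin d) (Polynomial K)))
    (m : ℕ) (E : Fin m → ModuleCat.{u} Aᵐᵒᵖ),
    ∀ (M : Type u) [AddCommGroup M] [Module Aᵐᵒᵖ M] [Module K M] [IsScalarTower K Aᵐᵒᵖ M],
      Module.Finite K M → Module.finrank K M = d → IsIndecomposableModule Aᵐᵒᵖ M →
        (∃ k, Nonempty (M ≃ₗ[Aᵐᵒᵖ] E k)) ∨
        ∃ (k : Fin n) (t : K) (φ : M ≃ₗ[K] (Fin d → K)), ∀ (a : Aᵐᵒᵖ) (x : M),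
          φ (a • x) = ((F k a).map (Polynomial.eval t)).mulVec (φ x)

/-!
Write `A = KQ/I`. Tensoring over `A` with the simple left module `S_j` turns the bimodule
periodicity into `Ω⁴(S_j) ≅ S_j`. If `α : i ⟶ j` is the only arrow out of `i` and the only arrow
into `j`, then `rad(A e_j) = A α` and `rad(e_i A) = α A`. Hence right multiplication by `α` is a
projective cover `A e_i → rad(A e_j) = Ω(S_j)`, and since `A` is symmetric its kernel `Ω²(S_j)` is
the simple module `S_i`. So `Ω³(S_j) = rad(A e_i)`, and because its syzygy is `S_j`, its projective
cover is `A e_j`: the module `rad(A e_i)` is generated by one element `β` of `e_j A e_i`, which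
generates `rad(e_j A)` as well. Modulo the square of the radical `β` is a multiple of an arrow
`j ⟶ i`, the only one out of `j` and the only one into `i`. As `Q` is connected, it is an oriented
cycle with vertices `i` and `j`, so `A` is a Nakayama algebra and therefore of finite type.
-/

section ProjectiveCover

variable {R : Type u} [Ring R] {P M P' M' : Type v}
  [AddCommGroup P] [Module R P] [AddCommGroup M] [Module R M]
  [AddCommGroup P'] [Module R P'] [AddCommGroup M'] [Module R M']

theorem IsProjectiveCover.surjective_of_surjective_comp {π : P →ₗ[R] M} (hπ : IsProjectiveCover π)
    {N : Type*} [AddCommGroup N] [Module R N] {f : N →ₗ[R] P}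
    (hf : Function.Surjective (π ∘ₗ f)) : Function.Surjective f := by
  rw [← LinearMap.range_eq_top]
  refine hπ.2.2 _ (eq_top_iff.2 fun y _ => ?_)
  obtain ⟨x, hx⟩ := hf (π y)
  refine Submodule.mem_sup.2 ⟨f x, ⟨x, rfl⟩, y - f x, ?_, by abel⟩
  rw [LinearMap.mem_ker, map_sub, ← hx, LinearMap.comp_apply, sub_self]

theorem IsProjectiveCover.exists_linearEquiv {π : P →ₗ[R] M} {π' : P' →ₗ[R] M'}
    (hπ : IsProjectiveCover π) (hπ' : IsProjectiveCover π') (e : M ≃ₗ[R] M') :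
    ∃ F : P ≃ₗ[R] P', ∀ x, π' (F x) = e (π x) := by
  have := hπ.1
  have := hπ'.1
  obtain ⟨f, hf⟩ := Module.projective_lifting_property π' (e.toLinearMap ∘ₗ π) hπ'.2.1
  have hfs : Function.Surjective f := hπ'.surjective_of_surjective_comp <| by
    rw [hf]
    exact e.surjective.comp hπ.2.1
  obtain ⟨g, hg⟩ := Module.projective_lifting_property f LinearMap.id hfs
  have hfg : Function.RightInverse g f := LinearMap.congr_fun hg
  have hπg : π ∘ₗ g = e.symm.toLinearMap ∘ₗ π' := by
    ext y
    simpa [hfg y] using congrArg e.symm (LinearMap.congr_fun hf (g y)).symm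
  have hgs : Function.Surjective g := hπ.surjective_of_surjective_comp <| by
    rw [hπg]
    exact e.symm.surjective.comp hπ'.2.1
  have hgf : Function.LeftInverse g f := hfg.rightInverse_of_surjective hgs
  exact ⟨LinearEquiv.ofBijective f ⟨hgf.injective, hfs⟩, LinearMap.congr_fun hf⟩

theorem IsProjectiveCover.nonempty_ker_equiv {π : P →ₗ[R] M} {π' : P' →ₗ[R] M'}
    (hπ : IsProjectiveCover π) (hπ' : IsProjectiveCover π') (e : M ≃ₗ[R] M') :
    Nonempty (LinearMap.ker π ≃ₗ[R] LinearMap.ker π') := by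
  obtain ⟨F, hF⟩ := hπ.exists_linearEquiv hπ' e
  have hker : LinearMap.ker π = (LinearMap.ker π').comap F.toLinearMap := by
    ext x
    simp [hF]
  exact ⟨(LinearEquiv.ofEq _ _ hker).trans (F.ofSubmodule' _)⟩

end ProjectiveCover

section Syzygy

variable {R : Type u} [Ring R] {M M' N N' : ModuleCat.{u} R}

theorem IsSyzygy.nonempty_equiv (h : IsSyzygy M N) (h' : IsSyzygy M' N') (e : M ≃ₗ[R] M') :
    Nonempty (N ≃ₗ[R] N') := by
  obtain ⟨_, _, -, hπ, ⟨f⟩⟩ := h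
  obtain ⟨_, _, -, hπ', ⟨f'⟩⟩ := h'
  exact (hπ.nonempty_ker_equiv hπ' e).map fun g => (f.trans g).trans f'.symm

theorem IsSyzygy.of_equiv (h : IsSyzygy M N) (e : M ≃ₗ[R] M') (f : N ≃ₗ[R] N') :
    IsSyzygy M' N' := by
  obtain ⟨P, ρ, hfin, ⟨hP, hs, hk⟩, ⟨g⟩⟩ := h
  have hker : LinearMap.ker ρ = LinearMap.ker (e.toLinearMap ∘ₗ ρ) := (e.ker_comp ρ).symm
  exact ⟨P, e.toLinearMap ∘ₗ ρ, hfin, ⟨hP, e.surjective.comp hs, hker ▸ hk⟩,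
    ⟨(f.symm.trans g).trans (LinearEquiv.ofEq _ _ hker)⟩⟩

theorem IsIteratedSyzygy.nonempty_equiv {d : ℕ} (h : IsIteratedSyzygy M d N)
    (h' : IsIteratedSyzygy M d N') : Nonempty (N ≃ₗ[R] N') := by
  induction d generalizing N N' with
  | zero =>
    obtain ⟨e⟩ := h
    exact h'.map fun e' => e.trans e'.symm
  | succ d ih =>
    obtain ⟨L, hL, hN⟩ := h
    obtain ⟨L', hL', hN'⟩ := h'
    obtain ⟨e⟩ := ih hL hL'
    exact hN.nonempty_equiv hN' e

theorem IsIteratedSyzygy.of_equiv {d : ℕ} (h : IsIteratedSyzygy M d N) (e : M ≃ₗ[R] M')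
    (f : N ≃ₗ[R] N') : IsIteratedSyzygy M' d N' := by
  induction d generalizing N N' with
  | zero => exact h.map fun g => (f.symm.trans g).trans e
  | succ d ih =>
    obtain ⟨L, hL, hN⟩ := h
    exact ⟨L, ih hL (LinearEquiv.refl R L), hN.of_equiv (LinearEquiv.refl R L) f⟩

end Syzygy

section BaseChange

variable {S A : Type*} [Ring S] [Ring A] (φ : S →+* A)

/-- The base change `A ⊗ M` of an `S`-module `M` along a surjective ring homomorphism `φ : S → A`,
realised as the quotient of `M` by `ker φ • M` because there is no tensor product over a
noncommutative ring. -/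
def BaseChange (M : Type*) [AddCommGroup M] [Module S M] : Type _ :=
  M ⧸ RingHom.ker φ • (⊤ : Submodule S M)

namespace BaseChange

section Module

variable (M : Type*) [AddCommGroup M] [Module S M]

instance : AddCommGroup (BaseChange φ M) :=
  inferInstanceAs (AddCommGroup (M ⧸ RingHom.ker φ • (⊤ : Submodule S M)))

noncomputable instance [RingHomSurjective φ] : Module A (BaseChange φ M) :=
  letI : Module (S ⧸ RingHom.ker φ) (BaseChange φ M) :=
    inferInstanceAs (Module (S ⧸ RingHom.ker φ) (M ⧸ RingHom.ker φ • (⊤ : Submodule S M)))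
  Module.compHom _
    (RingHom.quotientKerEquivOfSurjective (RingHom.surjective φ)).symm.toRingHom

/-- The canonical map from a module to its base change. -/
def mk [RingHomSurjective φ] : M →ₛₗ[φ] BaseChange φ M where
  toFun := Submodule.Quotient.mk
  map_add' _ _ := rfl
  map_smul' s x := by
    change _ = ((RingHom.quotientKerEquivOfSurjective (RingHom.surjective φ)).symm (φ s) :
      S ⧸ RingHom.ker φ) • Submodule.Quotient.mk x
    have : (RingHom.quotientKerEquivOfSurjective (RingHom.surjective φ)).symm (φ s) =
        Ideal.Quotient.mk (RingHom.ker φ) s :=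
      (RingEquiv.symm_apply_eq _).2 rfl
    rw [this]
    rfl

end Module

variable {φ} {M N : Type*} [AddCommGroup M] [Module S M] [AddCommGroup N] [Module S N]

theorem ker_smul_top_le_ker {X : Type*} [AddCommGroup X] [Module A X] (f : M →ₛₗ[φ] X) :
    RingHom.ker φ • (⊤ : Submodule S M) ≤ LinearMap.ker f :=
  Submodule.smul_le.2 fun s hs x _ => by
    rw [LinearMap.mem_ker, f.map_smulₛₗ, (RingHom.mem_ker).1 hs, zero_smul]

variable [RingHomSurjective φ]

theorem mk_surjective : Function.Surjective (mk φ M) :=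
  Submodule.Quotient.mk_surjective _

theorem mk_eq_zero {x : M} : mk φ M x = 0 ↔ x ∈ RingHom.ker φ • (⊤ : Submodule S M) :=
  Submodule.Quotient.mk_eq_zero _

/-- The linear map out of the base change induced by a semilinear map. -/
noncomputable def lift {X : Type*} [AddCommGroup X] [Module A X] (f : M →ₛₗ[φ] X) :
    BaseChange φ M →ₗ[A] X where
  toFun := QuotientAddGroup.lift _ f.toAddMonoidHom fun _ hx => ker_smul_top_le_ker f hx
  map_add' := map_add _
  map_smul' a x := by
    obtain ⟨s, rfl⟩ := RingHom.surjective φ a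
    obtain ⟨x, rfl⟩ := mk_surjective x
    rw [← LinearMap.map_smulₛₗ]
    exact f.map_smulₛₗ s x

variable (φ) in
/-- Functoriality of the base change. -/
noncomputable def map (f : M →ₗ[S] N) : BaseChange φ M →ₗ[A] BaseChange φ N :=
  lift ((mk φ N).comp f)

theorem map_mk (f : M →ₗ[S] N) (x : M) : map φ f (mk φ M x) = mk φ N (f x) := rfl

theorem map_surjective {f : M →ₗ[S] N} (hf : Function.Surjective f) :
    Function.Surjective (map φ f) := by
  intro y
  obtain ⟨y, rfl⟩ := mk_surjective y
  obtain ⟨x, rfl⟩ := hf y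
  exact ⟨mk φ M x, rfl⟩

variable (φ) in
/-- Functoriality of the base change for isomorphisms. -/
noncomputable def mapEquiv (e : M ≃ₗ[S] N) : BaseChange φ M ≃ₗ[A] BaseChange φ N :=
  LinearEquiv.ofLinearMap (map φ e.toLinearMap) (map φ e.symm.toLinearMap)
    (by
      ext y
      obtain ⟨y, rfl⟩ := mk_surjective y
      simp [map_mk])
    (by
      ext x
      obtain ⟨x, rfl⟩ := mk_surjective x
      simp [map_mk])

theorem exists_mem_ker_of_map_eq_zero {f : M →ₗ[S] N} (hf : Function.Surjective f)
    {x : BaseChange φ M} (hx : map φ f x = 0) : ∃ y ∈ LinearMap.ker f, mk φ M y = x := by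
  obtain ⟨x, rfl⟩ := mk_surjective x
  have hker : (RingHom.ker φ • ⊤ : Submodule S N) = (RingHom.ker φ • ⊤ : Submodule S M).map f := by
    rw [Submodule.map_smul'', Submodule.map_top, LinearMap.range_eq_top.2 hf]
  rw [map_mk, mk_eq_zero, hker] at hx
  obtain ⟨z, hz, hzx⟩ := hx
  refine ⟨x - z, by rw [LinearMap.mem_ker, map_sub, hzx, sub_self], ?_⟩
  rw [map_sub, mk_eq_zero.2 hz, sub_zero]

instance finite [Module.Finite S M] : Module.Finite A (BaseChange φ M) :=
  Module.Finite.of_surjective (mk φ M) mk_surjective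

instance projective [Module.Projective S M] : Module.Projective A (BaseChange φ M) := by
  obtain ⟨s, hs⟩ := Module.projective_def'.1 (inferInstance : Module.Projective S M)
  let toFinsupp : M →ₛₗ[φ] (M →₀ A) :=
    { toFun := fun x => (s x).mapRange φ (map_zero φ)
      map_add' := fun x y => by rw [map_add, Finsupp.mapRange_add (map_add φ)]
      map_smul' := fun a x => by
        ext
        simp }
  refine Module.Projective.of_split (lift toFinsupp) (Finsupp.linearCombination A (mk φ M)) ?_
  have hcomb (z : M →₀ S) : Finsupp.linearCombination A (mk φ M) (z.mapRange φ (map_zero φ)) =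
      mk φ M (Finsupp.linearCombination S id z) := by
    induction z using Finsupp.induction_linear with
    | zero => simp
    | add z w hz hw => rw [Finsupp.mapRange_add (map_add φ), map_add, hz, hw, map_add, map_add]
    | single x a => simp
  ext x
  obtain ⟨x, rfl⟩ := mk_surjective x
  exact (hcomb (s x)).trans (congrArg (mk φ M) (LinearMap.congr_fun hs x))

theorem isProjectiveCover_map {P L : Type v} [AddCommGroup P] [Module S P]
    [AddCommGroup L] [Module S L] {π : P →ₗ[S] L} (hπ : IsProjectiveCover π) :
    IsProjectiveCover (map φ π) := by
  obtain ⟨hP, hs, hk⟩ := hπ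
  refine ⟨inferInstance, map_surjective hs, fun U hU => ?_⟩
  have hcomap : U.comap (mk φ P) = ⊤ := by
    refine hk _ (eq_top_iff.2 fun x _ => ?_)
    obtain ⟨y, hy, z, hz, hyz⟩ := Submodule.mem_sup.1 (hU.symm ▸ Submodule.mem_top : mk φ P x ∈ _)
    obtain ⟨n, hn, rfl⟩ := exists_mem_ker_of_map_eq_zero hs hz
    refine Submodule.mem_sup.2 ⟨x - n, ?_, n, hn, by abel⟩
    rw [Submodule.mem_comap, map_sub, ← hyz, add_sub_cancel_right]
    exact hy
  refine eq_top_iff.2 fun x _ => ?_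
  obtain ⟨x, rfl⟩ := mk_surjective x
  exact (hcomap.symm ▸ Submodule.mem_top : x ∈ U.comap (mk φ P))

/-- Base change is only right exact in general; a retraction onto the kernel that is compatible with
`ker φ` makes it exact. -/
theorem nonempty_ker_equiv {π : M →ₗ[S] N} (hπ : Function.Surjective π)
    (r : M →+ LinearMap.ker π) (hr : ∀ x : LinearMap.ker π, r x = x)
    (hrφ : ∀ x ∈ (RingHom.ker φ • ⊤ : Submodule S M),
      r x ∈ (RingHom.ker φ • ⊤ : Submodule S (LinearMap.ker π))) :
    Nonempty (BaseChange φ (LinearMap.ker π) ≃ₗ[A] LinearMap.ker (map φ π)) := by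
  let j := map φ (LinearMap.ker π).subtype
  have hj : Function.Injective j := by
    rw [injective_iff_map_eq_zero]
    intro x hx
    obtain ⟨x, rfl⟩ := mk_surjective x
    rw [mk_eq_zero, ← hr x]
    exact hrφ _ (mk_eq_zero.1 hx)
  refine ⟨(LinearEquiv.ofInjective j hj).trans (LinearEquiv.ofEq _ _ ?_)⟩
  ext y
  constructor
  · rintro ⟨x, rfl⟩
    obtain ⟨x, rfl⟩ := mk_surjective x
    rw [LinearMap.mem_ker, map_mk, map_mk, Submodule.subtype_apply, LinearMap.map_coe_ker, map_zero]
  · intro hy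
    obtain ⟨n, hn, rfl⟩ := exists_mem_ker_of_map_eq_zero hπ hy
    exact ⟨mk φ _ ⟨n, hn⟩, rfl⟩

end BaseChange

end BaseChange

section RestrictScalars

variable {B S : Type*} [Ring B] [Ring S]

theorem exists_retraction_ker {M N : Type*} [AddCommGroup M] [Module B M] [AddCommGroup N]
    [Module B N] [Module.Projective B N] (π : M →ₗ[B] N) (hπ : Function.Surjective π) :
    ∃ r : M →ₗ[B] LinearMap.ker π, r ∘ₗ (LinearMap.ker π).subtype = LinearMap.id := by
  obtain ⟨s, hs⟩ := π.exists_rightInverse_of_surjective (LinearMap.range_eq_top.2 hπ)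
  have hs' (y : N) : π (s y) = y := LinearMap.congr_fun hs y
  refine ⟨(LinearMap.id - s ∘ₗ π).codRestrict _ fun x => by simp [hs'], ?_⟩
  ext x
  simp

theorem projective_of_isScalarTower [Module B S] [IsScalarTower B S S] [Module.Projective B S]
    (M : Type*) [AddCommGroup M] [Module B M] [Module S M] [IsScalarTower B S M]
    [Module.Projective S M] : Module.Projective B M := by
  classical
  obtain ⟨s, hs⟩ := Module.projective_def'.1 (inferInstance : Module.Projective S M)
  have : Module.Projective B (M →₀ S) :=
    Module.Projective.of_equiv' (finsuppLequivDFinsupp B).symm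
  exact Module.Projective.of_split (s.restrictScalars B)
    ((Finsupp.linearCombination S id).restrictScalars B)
    (LinearMap.ext fun x => LinearMap.congr_fun hs x)

/-- The restriction of the `S`-module `M` along `ψ : B → S` is projective. -/
def IsProjectiveOver (ψ : B →+* S) (M : Type*) [AddCommGroup M] [Module S M] : Prop :=
  letI := Module.compHom M ψ
  Module.Projective B M

variable {ψ : B →+* S} {M N : Type*} [AddCommGroup M] [Module S M] [AddCommGroup N] [Module S N]

theorem IsProjectiveOver.of_equiv (hM : IsProjectiveOver ψ M) (e : M ≃ₗ[S] N) :
    IsProjectiveOver ψ N := by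
  let _ := Module.compHom M ψ
  let _ := Module.compHom N ψ
  have : Module.Projective B M := hM
  exact Module.Projective.of_equiv' (R := B) (M := M)
    { e with map_smul' := fun b x => e.map_smul (ψ b) x }

theorem IsProjectiveOver.exists_retraction_ker (hN : IsProjectiveOver ψ N) {π : M →ₗ[S] N}
    (hπ : Function.Surjective π) :
    ∃ r : M →+ LinearMap.ker π, (∀ x : LinearMap.ker π, r x = x) ∧
      ∀ (b : B) (x : M), r (ψ b • x) = ψ b • r x := by
  let _ := Module.compHom M ψ
  let _ := Module.compHom N ψ
  have : Module.Projective B N := hN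
  obtain ⟨r, hr⟩ := _root_.exists_retraction_ker (B := B)
    { π with map_smul' := fun b x => π.map_smul (ψ b) x } hπ
  exact ⟨r.toAddMonoidHom, LinearMap.congr_fun hr, r.map_smul⟩

theorem IsProjectiveOver.ker (hS : IsProjectiveOver ψ S) (hN : IsProjectiveOver ψ N)
    [Module.Projective S M] {π : M →ₗ[S] N} (hπ : Function.Surjective π) :
    IsProjectiveOver ψ (LinearMap.ker π) := by
  obtain ⟨r, hr, hrψ⟩ := hN.exists_retraction_ker hπ
  let _ := Module.compHom S ψ
  let _ := Module.compHom M ψ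
  let _ := Module.compHom (LinearMap.ker π) ψ
  have : Module.Projective B S := hS
  have : IsScalarTower B S S := ⟨fun b s t => mul_assoc (ψ b) s t⟩
  have : IsScalarTower B S M := ⟨fun b s x => mul_smul (ψ b) s x⟩
  have : Module.Projective B M := projective_of_isScalarTower (S := S) M
  exact Module.Projective.of_split (M := M)
    { toFun := Subtype.val, map_add' := fun _ _ => rfl, map_smul' := fun _ _ => rfl }
    { r with map_smul' := hrψ } (LinearMap.ext hr)

end RestrictScalars

section TensorProduct

variable {K : Type*} [Field K] {A B : Type*} [Ring A] [Algebra K A] [Ring B] [Algebra K B]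

open Algebra.TensorProduct in
theorem isProjectiveOver_includeRight :
    IsProjectiveOver (includeRight : B →ₐ[K] A ⊗[K] B).toRingHom (A ⊗[K] B) := by
  let _ := Module.compHom (A ⊗[K] B) (includeRight : B →ₐ[K] A ⊗[K] B).toRingHom
  let E := TensorProduct.equivFinsuppOfBasisLeft (N := B) (Module.Free.chooseBasis K A)
  have hE (c : B) (x : A ⊗[K] B) : E ((1 : A) ⊗ₜ[K] c * x) = c • E x := by
    induction x with
    | zero => simp
    | add x y hx hy => rw [mul_add, map_add, hx, hy, map_add, smul_add]
    | tmul a d =>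
      ext i
      simp [E]
  exact Module.Projective.of_equiv' (R := B) (M := Module.Free.ChooseBasisIndex K A →₀ B)
    (LinearEquiv.symm { E with map_smul' := hE })

/-- The algebra map `A ⊗ B → A` induced by a character of `B`. -/
noncomputable def evalRight (A : Type*) [Ring A] [Algebra K A] (χ : B →ₐ[K] K) :
    A ⊗[K] B →ₐ[K] A :=
  Algebra.TensorProduct.lift (AlgHom.id K A) ((Algebra.ofId K A).comp χ)
    fun a b => (Algebra.commutes (χ b) a).symm

variable (χ : B →ₐ[K] K)

theorem evalRight_tmul (a : A) (b : B) : evalRight A χ (a ⊗ₜ[K] b) = a * algebraMap K A (χ b) :=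
  Algebra.TensorProduct.lift_tmul _ _ _ a b

instance : RingHomSurjective (evalRight A χ).toRingHom :=
  ⟨fun a => ⟨a ⊗ₜ[K] 1, by simp [evalRight_tmul]⟩⟩

variable {M N : Type*} [AddCommGroup M] [Module (A ⊗[K] B) M] [AddCommGroup N]
  [Module (A ⊗[K] B) N]

theorem map_mem_ker_evalRight_smul_top {r : M →+ N}
    (hr : ∀ (b : B) (x : M), r (((1 : A) ⊗ₜ[K] b) • x) = ((1 : A) ⊗ₜ[K] b) • r x) {x : M}
    (hx : x ∈ (RingHom.ker (evalRight A χ).toRingHom • ⊤ : Submodule (A ⊗[K] B) M)) :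
    r x ∈ (RingHom.ker (evalRight A χ).toRingHom • ⊤ : Submodule (A ⊗[K] B) N) := by
  -- `ker (evalRight A χ)` is generated as a right ideal by the elements `1 ⊗ b` with `χ b = 0`.
  have key (s : A ⊗[K] B) (z : M) : r (s • z - (evalRight A χ s ⊗ₜ[K] (1 : B)) • z) ∈
      (RingHom.ker (evalRight A χ).toRingHom • ⊤ : Submodule (A ⊗[K] B) N) := by
    induction s with
    | zero => simp
    | add s t hs ht =>
      convert add_mem hs ht using 1
      rw [← map_add, add_smul, map_add, TensorProduct.add_tmul, add_smul]
      congr 1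
      abel
    | tmul a b =>
      have hb : evalRight A χ ((1 : A) ⊗ₜ[K] (b - algebraMap K B (χ b))) = 0 := by
        simp [evalRight_tmul]
      have hab : (a ⊗ₜ[K] b : A ⊗[K] B) - evalRight A χ (a ⊗ₜ[K] b) ⊗ₜ[K] 1 =
          ((1 : A) ⊗ₜ[K] (b - algebraMap K B (χ b))) * (a ⊗ₜ[K] 1) := by
        rw [evalRight_tmul, ← Algebra.commutes, ← Algebra.smul_def, TensorProduct.smul_tmul,
          ← Algebra.algebraMap_eq_smul_one, ← TensorProduct.tmul_sub,
          Algebra.TensorProduct.tmul_mul_tmul, one_mul, mul_one]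
      rw [← sub_smul, hab, mul_smul, hr]
      exact Submodule.smul_mem_smul hb trivial
  refine Submodule.smul_induction_on hx (fun s hs z _ => ?_) fun y z hy hz => ?_
  · have h := key s z
    rwa [show evalRight A χ s = 0 from hs, TensorProduct.zero_tmul, zero_smul, sub_zero] at h
  · rw [map_add]
    exact add_mem hy hz

end TensorProduct

section Syzygy

variable {K : Type v} [Field K] {A B : Type u} [Ring A] [Algebra K A] [Ring B] [Algebra K B]

theorem IsSyzygy.isProjectiveOver {S B : Type u} [Ring S] [Ring B] {ψ : B →+* S}
    {M N : ModuleCat.{u} S} (h : IsSyzygy M N) (hS : IsProjectiveOver ψ S)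
    (hM : IsProjectiveOver ψ M) : IsProjectiveOver ψ N := by
  obtain ⟨P, π, -, ⟨_, hs, -⟩, ⟨f⟩⟩ := h
  exact (hS.ker hM hs).of_equiv f.symm

open Algebra.TensorProduct in
theorem IsSyzygy.baseChange {M N : ModuleCat.{u} (A ⊗[K] B)} (h : IsSyzygy M N)
    (hM : IsProjectiveOver (includeRight : B →ₐ[K] A ⊗[K] B).toRingHom M) (χ : B →ₐ[K] K) :
    IsSyzygy (ModuleCat.of A (BaseChange (evalRight A χ).toRingHom M))
      (ModuleCat.of A (BaseChange (evalRight A χ).toRingHom N)) := by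
  obtain ⟨P, π, _, hπ, ⟨f⟩⟩ := h
  obtain ⟨r, hr, hrB⟩ := hM.exists_retraction_ker hπ.2.1
  obtain ⟨g⟩ := BaseChange.nonempty_ker_equiv (φ := (evalRight A χ).toRingHom) hπ.2.1 r hr
    fun _ => map_mem_ker_evalRight_smul_top χ hrB
  exact ⟨ModuleCat.of A (BaseChange _ P), BaseChange.map _ π, BaseChange.finite,
    BaseChange.isProjectiveCover_map hπ, ⟨(BaseChange.mapEquiv _ f).trans g⟩⟩

open Algebra.TensorProduct in
theorem IsIteratedSyzygy.baseChange {M N : ModuleCat.{u} (A ⊗[K] B)} {d : ℕ}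
    (h : IsIteratedSyzygy M d N)
    (hM : IsProjectiveOver (includeRight : B →ₐ[K] A ⊗[K] B).toRingHom M) (χ : B →ₐ[K] K) :
    IsProjectiveOver (includeRight : B →ₐ[K] A ⊗[K] B).toRingHom N ∧
      IsIteratedSyzygy (ModuleCat.of A (BaseChange (evalRight A χ).toRingHom M)) d
        (ModuleCat.of A (BaseChange (evalRight A χ).toRingHom N)) := by
  induction d generalizing N with
  | zero =>
    obtain ⟨e⟩ := h
    exact ⟨hM.of_equiv e.symm, ⟨BaseChange.mapEquiv _ e⟩⟩
  | succ d ih =>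
    obtain ⟨L, hML, hLN⟩ := h
    obtain ⟨hL, hMd⟩ := ih hML
    exact ⟨hLN.isProjectiveOver isProjectiveOver_includeRight hL, _, hMd, hLN.baseChange hL χ⟩

end Syzygy

section RegularBimodule

variable (K : Type v) [Field K] (A : Type u) [Ring A] [Algebra K A]

/-- The identification of `A` with the underlying group of the regular bimodule. -/
noncomputable def toRegularBimodule : A ≃+ regularBimodule K A :=
  AddEquiv.refl A

variable {K A}

theorem tmul_smul_toRegularBimodule (a : A) (b : Aᵐᵒᵖ) (x : A) :
    (a ⊗ₜ[K] b) • toRegularBimodule K A x = toRegularBimodule K A (a * x * b.unop) :=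
  AlgHom.mulLeftRight_apply K A a b x

open Algebra.TensorProduct in
theorem isProjectiveOver_regularBimodule :
    IsProjectiveOver (includeRight : Aᵐᵒᵖ →ₐ[K] A ⊗[K] Aᵐᵒᵖ).toRingHom (regularBimodule K A) := by
  let _ := Module.compHom (regularBimodule K A)
    (includeRight : Aᵐᵒᵖ →ₐ[K] A ⊗[K] Aᵐᵒᵖ).toRingHom
  refine Module.Projective.of_equiv' (R := Aᵐᵒᵖ) (M := Aᵐᵒᵖ)
    { MulOpposite.opAddEquiv.symm.trans (toRegularBimodule K A) with
      map_smul' := fun b c => ?_ }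
  have h := tmul_smul_toRegularBimodule (K := K) 1 b c.unop
  rw [one_mul] at h
  exact h.symm

/-- The character of the opposite algebra given by a character. -/
noncomputable def opCharacter (χ : A →ₐ[K] K) : Aᵐᵒᵖ →ₐ[K] K :=
  χ.fromOpposite fun _ _ => Commute.all _ _

theorem nonempty_baseChange_regularBimodule_equiv (χ : A →ₐ[K] K) :
    Nonempty (BaseChange (evalRight A (opCharacter χ)).toRingHom (regularBimodule K A) ≃ₗ[A]
      A ⧸ RingHom.ker χ) := by
  let φ := (evalRight A (opCharacter χ)).toRingHom
  let f : regularBimodule K A →ₛₗ[φ] A ⧸ RingHom.ker χ :=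
    { toFun := fun x => Submodule.Quotient.mk ((toRegularBimodule K A).symm x)
      map_add' := fun _ _ => rfl
      map_smul' := fun s x => by
        obtain ⟨x, rfl⟩ := (toRegularBimodule K A).surjective x
        induction s with
        | zero => simp
        | add s t hs ht =>
          rw [add_smul, map_add, Submodule.Quotient.mk_add, hs, ht, map_add, add_smul]
        | tmul a b =>
          rw [tmul_smul_toRegularBimodule, AddEquiv.symm_apply_apply, AddEquiv.symm_apply_apply,
            ← Submodule.Quotient.mk_smul, Submodule.Quotient.eq, RingHom.mem_ker]
          change χ (_ - evalRight A (opCharacter χ) (a ⊗ₜ[K] b) * x) = 0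
          simp [evalRight_tmul, opCharacter]
          ring }
  refine ⟨LinearEquiv.ofBijective (BaseChange.lift f) ⟨?_, ?_⟩⟩
  · rw [injective_iff_map_eq_zero]
    intro x hx
    obtain ⟨x, rfl⟩ := BaseChange.mk_surjective x
    obtain ⟨x, rfl⟩ := (toRegularBimodule K A).surjective x
    have hx' : χ x = 0 := (Submodule.Quotient.mk_eq_zero _).1 hx
    have hx1 : toRegularBimodule K A x =
        ((1 : A) ⊗ₜ[K] MulOpposite.op x) • toRegularBimodule K A 1 := by
      rw [tmul_smul_toRegularBimodule]
      simp
    rw [hx1, BaseChange.mk_eq_zero]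
    refine Submodule.smul_mem_smul ?_ trivial
    change evalRight A (opCharacter χ) _ = 0
    simp [evalRight_tmul, opCharacter, hx']
  · intro y
    obtain ⟨x, rfl⟩ := Submodule.Quotient.mk_surjective _ y
    exact ⟨BaseChange.mk φ _ (toRegularBimodule K A x), rfl⟩

theorem IsIteratedSyzygy.quotient_ker_character {d : ℕ}
    (h : IsIteratedSyzygy (regularBimodule K A) d (regularBimodule K A)) (χ : A →ₐ[K] K) :
    IsIteratedSyzygy (ModuleCat.of A (A ⧸ RingHom.ker χ)) d
      (ModuleCat.of A (A ⧸ RingHom.ker χ)) := by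
  obtain ⟨e⟩ := nonempty_baseChange_regularBimodule_equiv χ
  exact (h.baseChange isProjectiveOver_regularBimodule (opCharacter χ)).2.of_equiv e e

end RegularBimodule

namespace IsSymmetricAlgebraOver

variable {K : Type v} {A : Type u} [Field K] [Ring A] [Algebra K A]

theorem finrank_range_mulRight [FiniteDimensional K A] (hsymm : IsSymmetricAlgebraOver K A)
    (a : A) : Module.finrank K (LinearMap.range (LinearMap.mulRight K a)) =
      Module.finrank K (LinearMap.range (LinearMap.mulLeft K a)) := by
  obtain ⟨B, hB, -, hassoc⟩ := hsymm
  let E := LinearMap.BilinForm.toDual B hB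
  have hadj : E.toLinearMap ∘ₗ LinearMap.mulRight K a =
      (LinearMap.mulLeft K a).dualMap ∘ₗ E.toLinearMap := by
    ext x y
    exact hassoc x a y
  rw [← LinearMap.finrank_range_dualMap_eq_finrank_range (LinearMap.mulLeft K a),
    ← LinearMap.range_comp_of_range_eq_top _ (LinearEquiv.range E), ← hadj, LinearMap.range_comp]
  exact (LinearEquiv.finrank_map_eq E _).symm

theorem commute_of_mul_commutator_eq_zero (hsymm : IsSymmetricAlgebraOver K A) {x z : A}
    (h : ∀ y, x * (y * z - z * y) = 0) : Commute x z := by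
  obtain ⟨B, hB, hs, hassoc⟩ := hsymm
  refine sub_eq_zero.1 (hB.1 _ fun y => ?_)
  calc B (x * z - z * x) y = B x (z * y) - B (y * z) x := by
        rw [map_sub, LinearMap.sub_apply, hassoc, hs (z * x), ← hassoc y]
    _ = -B (x * (y * z - z * y)) 1 := by
        rw [hassoc x, mul_one, map_sub, hs (y * z), neg_sub]
    _ = 0 := by rw [h, map_zero, LinearMap.zero_apply, neg_zero]

theorem commute_of_commutator_mul_eq_zero (hsymm : IsSymmetricAlgebraOver K A) {x z : A}
    (h : ∀ y, (y * z - z * y) * x = 0) : Commute x z := by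
  obtain ⟨B, hB, hs, hassoc⟩ := hsymm
  refine sub_eq_zero.1 (hB.1 _ fun y => ?_)
  calc B (x * z - z * x) y = B x (z * y) - B (y * z) x := by
        rw [map_sub, LinearMap.sub_apply, hassoc, hs (z * x), ← hassoc y]
    _ = -B ((y * z - z * y) * x) 1 := by
        rw [hassoc _ x, mul_one, map_sub, LinearMap.sub_apply, hs (z * y), neg_sub]
    _ = 0 := by rw [h, map_zero, LinearMap.zero_apply, neg_zero]

end IsSymmetricAlgebraOver

theorem finrank_eq_finrank_add_finrank_ker {K A M N : Type*} [Field K] [Ring A] [Algebra K A]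
    [AddCommGroup M] [Module A M] [Module K M] [IsScalarTower K A M] [FiniteDimensional K M]
    [AddCommGroup N] [Module A N] [Module K N] [IsScalarTower K A N] {f : M →ₗ[A] N}
    (hf : Function.Surjective f) :
    Module.finrank K M = Module.finrank K N + Module.finrank K (LinearMap.ker f) := by
  rw [← (f.restrictScalars K).finrank_range_add_finrank_ker,
    LinearMap.range_eq_top.2 (show Function.Surjective (f.restrictScalars K) from hf), finrank_top]
  rfl

/-- The idempotents and simple characters of a basic algebra: a complete system of orthogonal
idempotents together with dual characters whose common kernel, the radical, is a nil ideal. -/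
structure VertexSystem (K A V : Type*) [Field K] [Ring A] [Algebra K A] [Fintype V] where
  /-- the idempotents -/
  e : V → A
  /-- the characters -/
  χ : V → A →ₐ[K] K
  complete : CompleteOrthogonalIdempotents e
  χ_e_self : ∀ a, χ a (e a) = 1
  isNilpotent : ∀ x, (∀ a, χ a x = 0) → IsNilpotent x

namespace VertexSystem

section

variable {K A V : Type*} [Field K] [Ring A] [Algebra K A] [Fintype V] (D : VertexSystem K A V)

theorem e_mul_self (a : V) : D.e a * D.e a = D.e a := D.complete.idem a

theorem e_mul_e_mul (a : V) (x : A) : D.e a * (D.e a * x) = D.e a * x := by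
  rw [← mul_assoc, e_mul_self]

theorem χ_e_ne {a b : V} (h : b ≠ a) : D.χ b (D.e a) = 0 := by
  have := congrArg (D.χ b) (D.complete.ortho h)
  rwa [map_mul, χ_e_self, one_mul, map_zero] at this

theorem χ_eq_zero_of_mul_e {a b : V} (h : b ≠ a) {x : A} (hx : x * D.e a = x) : D.χ b x = 0 := by
  rw [← hx, map_mul, χ_e_ne _ h, mul_zero]

theorem χ_eq_zero_of_e_mul {a b : V} (h : b ≠ a) {x : A} (hx : D.e a * x = x) : D.χ b x = 0 := by
  rw [← hx, map_mul, χ_e_ne _ h, zero_mul]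

/-- The radical of the algebra: the common kernel of the characters. -/
def rad : Ideal A := ⨅ a, RingHom.ker (D.χ a)

theorem mem_rad {x : A} : x ∈ D.rad ↔ ∀ a, D.χ a x = 0 := by
  simp [rad, RingHom.mem_ker]

instance : D.rad.IsTwoSided :=
  ⟨fun y hx => D.mem_rad.2 fun a => by rw [map_mul, D.mem_rad.1 hx, zero_mul]⟩

theorem commutator_mem_rad (y z : A) : y * z - z * y ∈ D.rad :=
  D.mem_rad.2 fun a => by rw [map_sub, map_mul, map_mul, mul_comm, sub_self]

theorem commute_of_mul_rad_eq_zero (hsymm : IsSymmetricAlgebraOver K A) {x : A}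
    (hx : ∀ r ∈ D.rad, x * r = 0) (z : A) : Commute x z :=
  hsymm.commute_of_mul_commutator_eq_zero fun y => hx _ (D.commutator_mem_rad y z)

theorem commute_of_rad_mul_eq_zero (hsymm : IsSymmetricAlgebraOver K A) {x : A}
    (hx : ∀ r ∈ D.rad, r * x = 0) (z : A) : Commute x z :=
  hsymm.commute_of_commutator_mul_eq_zero fun y => hx _ (D.commutator_mem_rad y z)

/-- The projective left ideal `A e_a`. -/
def left (a : V) : Submodule A A := LinearMap.range (LinearMap.toSpanSingleton A A (D.e a))

theorem mem_left {a : V} {x : A} : x ∈ D.left a ↔ x * D.e a = x := by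
  constructor
  · rintro ⟨y, rfl⟩
    simp [mul_assoc, e_mul_self]
  · exact fun hx => ⟨x, hx⟩

/-- The idempotent `e_a` as the generator of `A e_a`. -/
def gen (a : V) : D.left a := ⟨D.e a, D.mem_left.2 (D.e_mul_self a)⟩

theorem coe_gen (a : V) : (D.gen a : A) = D.e a := rfl

theorem smul_gen {a : V} (x : D.left a) : (x : A) • D.gen a = x :=
  Subtype.ext (D.mem_left.1 x.2)

theorem eq_top_of_gen_mem {a : V} {U : Submodule A (D.left a)} (h : D.gen a ∈ U) : U = ⊤ :=
  eq_top_iff.2 fun x _ => D.smul_gen x ▸ U.smul_mem _ h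

theorem projective_left (a : V) : Module.Projective A (D.left a) := by
  refine Module.Projective.of_split (M := A) (D.left a).subtype
    (LinearMap.toSpanSingleton A (D.left a) (D.gen a)) ?_
  ext x
  exact congrArg Subtype.val (D.smul_gen x)

/-- The radical of the projective module `A e_a`. -/
def radLeft (a : V) : Submodule A (D.left a) := Submodule.comap (D.left a).subtype D.rad

theorem mem_radLeft_iff_χ {a : V} {x : D.left a} : x ∈ D.radLeft a ↔ D.χ a (x : A) = 0 := by
  refine D.mem_rad.trans ⟨fun h => h a, fun h b => ?_⟩
  by_cases hb : b = a
  · rwa [hb]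
  · exact D.χ_eq_zero_of_mul_e hb (D.mem_left.1 x.2)

/-- `x = (c + r) e_a` with `c = χ_a x ≠ 0` and `r` nilpotent, so that `c + r` is a unit. -/
theorem exists_smul_eq_gen {a : V} {x : D.left a} (hx : x ∉ D.radLeft a) :
    ∃ y : A, y • x = D.gen a := by
  have hc : D.χ a x ≠ 0 := fun h => hx (D.mem_radLeft_iff_χ.2 h)
  set c := algebraMap K A (D.χ a x)
  have hr : IsNilpotent ((x : A) - c * D.e a) := by
    have hmem : x - c • D.gen a ∈ D.radLeft a := by
      rw [mem_radLeft_iff_χ]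
      simp [c, coe_gen, χ_e_self]
    exact D.isNilpotent _ (D.mem_rad.1 hmem)
  obtain ⟨y, hy⟩ := (hr.isUnit_add_left_of_commute ((IsUnit.mk0 _ hc).map (algebraMap K A))
    (Algebra.commutes _ _).symm).exists_left_inv
  refine ⟨y, Subtype.ext ?_⟩
  calc y * (x : A) = y * ((c + ((x : A) - c * D.e a)) * D.e a) := by
        rw [add_mul, sub_mul, mul_assoc c, e_mul_self, D.mem_left.1 x.2, add_sub_cancel]
    _ = D.e a := by rw [← mul_assoc, hy, one_mul]

theorem eq_top_of_notMem_radLeft {a : V} {U : Submodule A (D.left a)} {x : D.left a}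
    (hxU : x ∈ U) (hx : x ∉ D.radLeft a) : U = ⊤ := by
  obtain ⟨y, hy⟩ := D.exists_smul_eq_gen hx
  exact D.eq_top_of_gen_mem (hy ▸ U.smul_mem y hxU)

theorem gen_notMem_radLeft (a : V) : D.gen a ∉ D.radLeft a := by
  rw [mem_radLeft_iff_χ, coe_gen, χ_e_self]
  exact one_ne_zero

theorem isProjectiveCover_of_ker_le {a : V} {M : Type _} [AddCommGroup M] [Module A M]
    {π : D.left a →ₗ[A] M} (hs : Function.Surjective π) (hk : LinearMap.ker π ≤ D.radLeft a) :
    IsProjectiveCover π := by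
  refine ⟨D.projective_left a, hs, fun U hU => ?_⟩
  by_contra hne
  refine D.gen_notMem_radLeft a ((?_ : (⊤ : Submodule A (D.left a)) ≤ _) trivial)
  rw [← hU]
  exact sup_le (fun x hxU => not_not.1 fun hx => hne (D.eq_top_of_notMem_radLeft hxU hx)) hk

section

variable {T : Type*} [AddCommGroup T] [Module A T]

/-- The map `A e_a → T`, `x ↦ x • t`. -/
def toSpan (a : V) (t : T) : D.left a →ₗ[A] T :=
  (LinearMap.toSpanSingleton A T t).domRestrict (D.left a)

theorem toSpan_apply (a : V) (t : T) (x : D.left a) : D.toSpan a t x = (x : A) • t := rfl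

theorem toSpan_surjective {a : V} {t : T} (he : D.e a • t = t) (ht : Submodule.span A {t} = ⊤) :
    Function.Surjective (D.toSpan a t) := by
  rw [← LinearMap.range_eq_top, eq_top_iff, ← ht, Submodule.span_singleton_le_iff_mem]
  exact ⟨D.gen a, he⟩

theorem ker_toSpan_le {a : V} {t : T} (he : D.e a • t = t) (ht : t ≠ 0) :
    LinearMap.ker (D.toSpan a t) ≤ D.radLeft a := by
  intro x hx
  by_contra hxr
  obtain ⟨y, hy⟩ := D.exists_smul_eq_gen hxr
  refine ht ?_
  rw [← he, ← coe_gen, ← toSpan_apply, ← hy, map_smul, LinearMap.mem_ker.1 hx, smul_zero]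

theorem ker_toSpan {a : V} {t : T} (he : D.e a • t = t) (ht : t ≠ 0)
    (hrad : ∀ r ∈ D.rad, r • t = 0) : LinearMap.ker (D.toSpan a t) = D.radLeft a :=
  le_antisymm (D.ker_toSpan_le he ht) fun x hx => hrad x hx

end

end

section

variable {K : Type v} {A : Type u} {V : Type*} [Field K] [Ring A] [Algebra K A] [Fintype V]
  (D : VertexSystem K A V) {T : Type u} [AddCommGroup T] [Module A T]

theorem isProjectiveCover_toSpan {a : V} {t : T} (he : D.e a • t = t) (ht0 : t ≠ 0)
    (ht : Submodule.span A {t} = ⊤) : IsProjectiveCover (D.toSpan a t) :=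
  D.isProjectiveCover_of_ker_le (D.toSpan_surjective he ht) (D.ker_toSpan_le he ht0)

theorem finite_left (a : V) : Module.Finite A (D.left a) :=
  Module.Finite.range (LinearMap.toSpanSingleton A A (D.e a))

/-- The simple left module at the vertex `a`. -/
abbrev Simple (a : V) : Type u := A ⧸ RingHom.ker (D.χ a)

theorem e_smul_simple_one (a : V) : D.e a • (1 : D.Simple a) = 1 := by
  change Submodule.Quotient.mk (D.e a * 1) = (Submodule.Quotient.mk 1 : D.Simple a)
  rw [Submodule.Quotient.eq, RingHom.mem_ker, mul_one, map_sub, map_one, χ_e_self, sub_self]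

theorem smul_simple_one_eq_zero (a : V) {r : A} : r • (1 : D.Simple a) = 0 ↔ D.χ a r = 0 := by
  change Submodule.Quotient.mk (r * 1) = (0 : D.Simple a) ↔ _
  rw [Submodule.Quotient.mk_eq_zero, RingHom.mem_ker, mul_one]

theorem simple_one_ne_zero (a : V) : (1 : D.Simple a) ≠ 0 := fun h => by
  have := (D.smul_simple_one_eq_zero a (r := 1)).1 (by rw [h, smul_zero])
  rw [map_one] at this
  exact one_ne_zero this

theorem span_simple_one (a : V) : Submodule.span A {(1 : D.Simple a)} = ⊤ := by
  refine eq_top_iff.2 fun y _ => ?_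
  obtain ⟨y, rfl⟩ := Submodule.Quotient.mk_surjective _ y
  refine Submodule.mem_span_singleton.2 ⟨y, ?_⟩
  change Submodule.Quotient.mk (y * 1) = _
  rw [mul_one]

theorem ker_toSpan_simple_one (a : V) :
    LinearMap.ker (D.toSpan a (1 : D.Simple a)) = D.radLeft a :=
  D.ker_toSpan (D.e_smul_simple_one a) (D.simple_one_ne_zero a) fun _ hr =>
    (D.smul_simple_one_eq_zero a).2 (D.mem_rad.1 hr a)

theorem isSyzygy_simple (a : V) :
    IsSyzygy (ModuleCat.of A (D.Simple a)) (ModuleCat.of A (D.radLeft a)) :=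
  ⟨ModuleCat.of A (D.left a), D.toSpan a 1, D.finite_left a,
    D.isProjectiveCover_toSpan (D.e_smul_simple_one a) (D.simple_one_ne_zero a)
      (D.span_simple_one a), ⟨LinearEquiv.ofEq _ _ (D.ker_toSpan_simple_one a).symm⟩⟩

theorem nonempty_equiv_simple {a : V} {t : T} (he : D.e a • t = t) (ht0 : t ≠ 0)
    (ht : Submodule.span A {t} = ⊤) (hrad : ∀ r ∈ D.rad, r • t = 0) :
    Nonempty (D.Simple a ≃ₗ[A] T) :=
  ⟨((D.toSpan a 1).quotKerEquivOfSurjective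
      (D.toSpan_surjective (D.e_smul_simple_one a) (D.span_simple_one a))).symm.trans <|
    (Submodule.quotEquivOfEq _ _
      ((D.ker_toSpan_simple_one a).trans (D.ker_toSpan he ht0 hrad).symm)).trans <|
    (D.toSpan a t).quotKerEquivOfSurjective (D.toSpan_surjective he ht)⟩

end

section Finrank

variable {K : Type v} {A : Type u} {V : Type*} [Field K] [Ring A] [Algebra K A] [Fintype V]
  (D : VertexSystem K A V)

theorem finrank_radLeft (a : V) : Module.finrank K (D.radLeft a) = Module.finrank K
    ((D.left a).restrictScalars K ⊓ D.rad.restrictScalars K : Submodule K A) := by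
  have h := Submodule.finrank_map_subtype_eq ((D.left a).restrictScalars K)
    ((D.radLeft a).restrictScalars K)
  rw [← Submodule.map_comap_subtype]
  exact h.symm

theorem mem_range_mulLeft_e {a : V} {x : A} :
    x ∈ LinearMap.range (LinearMap.mulLeft K (D.e a)) ↔ D.e a * x = x := by
  constructor
  · rintro ⟨y, rfl⟩
    exact D.e_mul_e_mul a y
  · exact fun hx => ⟨x, hx⟩

theorem finrank_radLeft_eq_finrank_range_mulRight {a : V} {α : A}
    (hα : ∀ x, x ∈ Ideal.span {α} ↔ x * D.e a = x ∧ x ∈ D.rad) :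
    Module.finrank K (D.radLeft a) =
      Module.finrank K (LinearMap.range (LinearMap.mulRight K α)) := by
  have hrange : (D.left a).restrictScalars K ⊓ D.rad.restrictScalars K =
      LinearMap.range (LinearMap.mulRight K α) := by
    ext x
    exact (and_congr_left' D.mem_left).trans <| (hα x).symm.trans Ideal.mem_span_singleton'
  rw [finrank_radLeft, hrange]

variable [FiniteDimensional K A]

theorem finrank_eq_finrank_inf_rad_add_one {W : Submodule K A} {a : V} (ha : D.e a ∈ W)
    (hW : ∀ x ∈ W, ∀ b, b ≠ a → D.χ b x = 0) :
    Module.finrank K W =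
      Module.finrank K (W ⊓ D.rad.restrictScalars K : Submodule K A) + 1 := by
  let f : W →ₗ[K] K := (D.χ a).toLinearMap.domRestrict W
  have hf : LinearMap.range f = ⊤ :=
    LinearMap.range_eq_top.2 fun c => ⟨c • ⟨D.e a, ha⟩, by simp [f, χ_e_self]⟩
  have hker : (LinearMap.ker f).map W.subtype = W ⊓ D.rad.restrictScalars K := by
    ext x
    constructor
    · rintro ⟨x, hx, rfl⟩
      refine ⟨x.2, D.mem_rad.2 fun b => ?_⟩
      by_cases hb : b = a
      · rw [hb]
        exact hx
      · exact hW x x.2 b hb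
    · rintro ⟨hxW, hx⟩
      exact ⟨⟨x, hxW⟩, D.mem_rad.1 hx a, rfl⟩
  rw [← f.finrank_range_add_finrank_ker, hf, finrank_top, Module.finrank_self, add_comm, ← hker,
    LinearEquiv.finrank_eq (Submodule.equivSubtypeMap W (LinearMap.ker f))]

theorem finrank_left (a : V) :
    Module.finrank K (D.left a) = Module.finrank K (D.radLeft a) + 1 := by
  rw [finrank_radLeft]
  exact D.finrank_eq_finrank_inf_rad_add_one (W := (D.left a).restrictScalars K)
    (D.gen a).2 fun _ hx _ hb => D.χ_eq_zero_of_mul_e hb (D.mem_left.1 hx)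

/-- Over a symmetric algebra, `A e_a` and `e_a A` have the same dimension. -/
theorem finrank_left_eq_of_symmetric (hsymm : IsSymmetricAlgebraOver K A) (a : V) :
    Module.finrank K (D.left a) = Module.finrank K
      (LinearMap.range (LinearMap.mulLeft K (D.e a)) ⊓ D.rad.restrictScalars K :
        Submodule K A) + 1 := by
  rw [← D.finrank_eq_finrank_inf_rad_add_one (D.mem_range_mulLeft_e.2 (D.e_mul_self a))
    fun x hx b hb => D.χ_eq_zero_of_e_mul hb (D.mem_range_mulLeft_e.1 hx),
    ← hsymm.finrank_range_mulRight]
  rfl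

theorem finrank_simple (a : V) : Module.finrank K (D.Simple a) = 1 := by
  have h := finrank_eq_finrank_add_finrank_ker (K := K)
    (D.toSpan_surjective (D.e_smul_simple_one a) (D.span_simple_one a))
  rw [ker_toSpan_simple_one, finrank_left] at h
  omega

end Finrank

/-- An element `α` of `e_i A e_j` that generates the radical of `A e_j` as a left module and the
radical of `e_i A` as a right module. -/
structure IsBigenerator {K A V : Type*} [Field K] [Ring A] [Algebra K A] [Fintype V]
    (D : VertexSystem K A V) (i j : V) (α : A) : Prop where
  ne_zero : α ≠ 0
  mem_span_iff : ∀ x, x ∈ Ideal.span {α} ↔ x * D.e j = x ∧ x ∈ D.rad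
  dvd_iff : ∀ x, α ∣ x ↔ D.e i * x = x ∧ x ∈ D.rad

namespace IsBigenerator

variable {K A V : Type*} [Field K] [Ring A] [Algebra K A] [Fintype V] {D : VertexSystem K A V}
  {i j : V} {α : A} (h : D.IsBigenerator i j α)

include h

theorem mem_rad : α ∈ D.rad := ((h.dvd_iff α).1 dvd_rfl).2

theorem e_mul : D.e i * α = α := ((h.dvd_iff α).1 dvd_rfl).1

theorem mul_e : α * D.e j = α := ((h.mem_span_iff α).1 (Ideal.mem_span_singleton_self α)).1

theorem finrank_left_eq [FiniteDimensional K A] (hsymm : IsSymmetricAlgebraOver K A) :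
    Module.finrank K (D.left i) = Module.finrank K (D.left j) := by
  have hrange : LinearMap.range (LinearMap.mulLeft K α) =
      LinearMap.range (LinearMap.mulLeft K (D.e i)) ⊓ D.rad.restrictScalars K := by
    ext x
    exact (exists_congr fun _ => eq_comm).trans <| (h.dvd_iff x).trans <|
      and_congr_left' D.mem_range_mulLeft_e.symm
  rw [D.finrank_left_eq_of_symmetric hsymm, ← hrange, ← hsymm.finrank_range_mulRight,
    D.finrank_left, D.finrank_radLeft_eq_finrank_range_mulRight h.mem_span_iff]

/-- The element `α` as a generator of the radical of `A e_j`. -/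
def radGen : D.radLeft j := ⟨⟨α, D.mem_left.2 h.mul_e⟩, h.mem_rad⟩

theorem e_smul_radGen : D.e i • h.radGen = h.radGen := Subtype.ext (Subtype.ext h.e_mul)

theorem radGen_ne_zero : h.radGen ≠ 0 := fun h0 =>
  h.ne_zero (congrArg (fun x : D.radLeft j => ((x : D.left j) : A)) h0)

theorem span_radGen : Submodule.span A {h.radGen} = ⊤ := by
  refine eq_top_iff.2 fun x _ => ?_
  obtain ⟨y, hy⟩ := Ideal.mem_span_singleton'.1
    ((h.mem_span_iff x).2 ⟨D.mem_left.1 x.1.2, x.2⟩)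
  exact Submodule.mem_span_singleton.2 ⟨y, Subtype.ext (Subtype.ext hy)⟩

theorem coe_mul_eq_zero {x : D.left i} (hx : D.toSpan i h.radGen x = 0) : (x : A) * α = 0 :=
  congrArg (fun x : D.radLeft j => ((x : D.left j) : A)) hx

theorem toSpan_radGen_surjective : Function.Surjective (D.toSpan i h.radGen) :=
  D.toSpan_surjective h.e_smul_radGen h.span_radGen

end IsBigenerator

variable {K : Type v} {A : Type u} {V : Type*} [Field K] [Ring A] [Algebra K A] [Fintype V]

theorem isBigenerator_of_surjective [FiniteDimensional K A] (D : VertexSystem K A V)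
    {i j : V} (hsymm : IsSymmetricAlgebraOver K A)
    (hdim : Module.finrank K (D.left i) = Module.finrank K (D.left j))
    (hpos : 0 < Module.finrank K (D.radLeft i)) {f : D.left j →ₗ[A] D.radLeft i}
    (hf : Function.Surjective f) : D.IsBigenerator j i ((f (D.gen j) : D.left i) : A) := by
  set b : D.radLeft i := f (D.gen j) with hb
  set β : A := ((b : D.left i) : A)
  have hsmul (x : D.left j) : f x = (x : A) • b := by rw [hb, ← map_smul, D.smul_gen]
  have he : D.e j * β = β :=
    congrArg (fun x : D.radLeft i => ((x : D.left i) : A)) (hsmul (D.gen j)).symm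
  have hspan : ∀ x, x ∈ Ideal.span {β} ↔ x * D.e i = x ∧ x ∈ D.rad := by
    intro x
    rw [Ideal.mem_span_singleton']
    constructor
    · rintro ⟨y, rfl⟩
      exact ⟨by rw [mul_assoc, D.mem_left.1 b.1.2], D.rad.mul_mem_left y b.2⟩
    · rintro ⟨hx, hxr⟩
      obtain ⟨y, hy⟩ := hf ⟨⟨x, D.mem_left.2 hx⟩, hxr⟩
      rw [hsmul] at hy
      exact ⟨y, congrArg (fun x : D.radLeft i => ((x : D.left i) : A)) hy⟩
  have hrank := D.finrank_radLeft_eq_finrank_range_mulRight hspan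
  have hrange : LinearMap.range (LinearMap.mulLeft K β) =
      LinearMap.range (LinearMap.mulLeft K (D.e j)) ⊓ D.rad.restrictScalars K := by
    refine Submodule.eq_of_le_of_finrank_eq ?_ ?_
    · rintro _ ⟨y, rfl⟩
      refine ⟨D.mem_range_mulLeft_e.2 ?_, D.rad.mul_mem_right y b.2⟩
      rw [LinearMap.mulLeft_apply, ← mul_assoc, he]
    · have hleft := D.finrank_left_eq_of_symmetric hsymm j
      rw [← hdim, D.finrank_left, hrank, hsymm.finrank_range_mulRight] at hleft
      omega
  refine ⟨fun h0 => ?_, hspan, fun x => ?_⟩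
  · rw [hrank, h0, LinearMap.mulRight_zero_eq_zero, LinearMap.range_zero, finrank_bot] at hpos
    exact lt_irrefl 0 hpos
  · exact (exists_congr fun _ => eq_comm).trans <| (SetLike.ext_iff.1 hrange x).trans <|
      and_congr_left' D.mem_range_mulLeft_e

namespace IsBigenerator

variable {D : VertexSystem K A V} {i j : V} {α : A}

/-- If the image of `f` avoided the top of `A e_j`, then `f` would factor through right
multiplication by `α`, which annihilates the socle. -/
theorem surjective_of_ne_zero (h : D.IsBigenerator i j α) (hsymm : IsSymmetricAlgebraOver K A)
    {P : Type*} [AddCommGroup P] [Module A P] [Module.Projective A P] {s : P}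
    (hrad : ∀ r ∈ D.rad, r • s = 0) {f : P →ₗ[A] D.left j} (hf : f s ≠ 0) :
    Function.Surjective f := by
  rw [← LinearMap.range_eq_top]
  by_contra hns
  have hfr (p : P) : f p ∈ D.radLeft j :=
    not_not.1 fun hp => hns (D.eq_top_of_notMem_radLeft ⟨p, rfl⟩ hp)
  obtain ⟨g, hg⟩ := Module.projective_lifting_property (D.toSpan i h.radGen)
    (f.codRestrict (D.radLeft j) hfr) h.toSpan_radGen_surjective
  have hgs : ∀ r ∈ D.rad, r * (g s : A) = 0 := fun r hr => by
    have := congrArg Subtype.val (g.map_smul r s)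
    rwa [hrad r hr, map_zero, eq_comm] at this
  have hfg : (f s : A) = (g s : A) * α :=
    congrArg (fun x : D.radLeft j => ((x : D.left j) : A)) (LinearMap.congr_fun hg s).symm
  refine hf (Subtype.ext (hfg.trans ?_))
  rw [(D.commute_of_rad_mul_eq_zero hsymm hgs α).eq, hgs α h.mem_rad]
  rfl

variable [FiniteDimensional K A]

theorem finrank_ker_toSpan (h : D.IsBigenerator i j α) (hsymm : IsSymmetricAlgebraOver K A) :
    Module.finrank K (LinearMap.ker (D.toSpan i h.radGen)) = 1 := by
  have hker := finrank_eq_finrank_add_finrank_ker (K := K) h.toSpan_radGen_surjective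
  have hleft := D.finrank_left j
  have hij := h.finrank_left_eq hsymm
  omega

theorem isSyzygy_radLeft (h : D.IsBigenerator i j α) (hsymm : IsSymmetricAlgebraOver K A) :
    IsSyzygy (ModuleCat.of A (D.radLeft j)) (ModuleCat.of A (D.Simple i)) := by
  obtain ⟨s, hs0, hs⟩ := finrank_eq_one_iff'.1 (h.finrank_ker_toSpan hsymm)
  have hmul : ∀ r ∈ D.rad, ((s : D.left i) : A) * r = 0 := by
    intro r hr
    obtain ⟨y, hy⟩ := (h.dvd_iff (D.e i * r)).2
      ⟨D.e_mul_e_mul i r, D.rad.mul_mem_left _ hr⟩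
    rw [← D.mem_left.1 (s : D.left i).2, mul_assoc, hy, ← mul_assoc, h.coe_mul_eq_zero s.2,
      zero_mul]
  have hcomm := D.commute_of_mul_rad_eq_zero hsymm hmul
  have he : D.e i • s = s := Subtype.ext <| Subtype.ext <|
    (hcomm _).eq.symm.trans (D.mem_left.1 (s : D.left i).2)
  have hrad : ∀ r ∈ D.rad, r • s = 0 := fun r hr =>
    Subtype.ext <| Subtype.ext <| (hcomm r).eq.symm.trans (hmul r hr)
  have hspan : Submodule.span A {s} = ⊤ := by
    refine eq_top_iff.2 fun y _ => ?_
    obtain ⟨c, rfl⟩ := hs y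
    exact Submodule.smul_of_tower_mem _ c (Submodule.mem_span_singleton_self s)
  obtain ⟨f⟩ := D.nonempty_equiv_simple he hs0 hspan hrad
  exact ⟨ModuleCat.of A (D.left i), D.toSpan i h.radGen, D.finite_left i,
    D.isProjectiveCover_toSpan h.e_smul_radGen h.radGen_ne_zero h.span_radGen, ⟨f⟩⟩

theorem isIteratedSyzygy_radLeft (h : D.IsBigenerator i j α)
    (hsymm : IsSymmetricAlgebraOver K A) :
    IsIteratedSyzygy (ModuleCat.of A (D.Simple j)) 3 (ModuleCat.of A (D.radLeft i)) :=
  ⟨_, ⟨_, ⟨_, ⟨LinearEquiv.refl A _⟩, D.isSyzygy_simple j⟩, h.isSyzygy_radLeft hsymm⟩,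
    D.isSyzygy_simple i⟩

theorem nonempty_equiv_left (h : D.IsBigenerator i j α) (hsymm : IsSymmetricAlgebraOver K A)
    {P : Type*} [AddCommGroup P] [Module A P] [Module.Projective A P] [Module K P]
    [IsScalarTower K A P] [FiniteDimensional K P]
    (hP : Module.finrank K P = Module.finrank K (D.left j)) {f : D.Simple j →ₗ[A] P}
    (hf : Function.Injective f) : Nonempty (P ≃ₗ[A] D.left j) := by
  have he : D.e j • f 1 = f 1 := by rw [← map_smul, D.e_smul_simple_one]
  have hrad : ∀ r ∈ D.rad, r • f 1 = 0 := fun r hr => by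
    rw [← map_smul, (D.smul_simple_one_eq_zero j).2 (D.mem_rad.1 hr j), map_zero]
  obtain ⟨φ, hφ⟩ := Module.Projective.exists_dual_ne_zero A
    ((map_ne_zero_iff f hf).2 (D.simple_one_ne_zero j))
  have hcomm : Commute (φ (f 1)) (D.e j) := D.commute_of_rad_mul_eq_zero hsymm
    (fun r hr => by rw [← smul_eq_mul, ← map_smul, hrad r hr, map_zero]) _
  have hφe : φ (f 1) * D.e j = φ (f 1) := by rw [hcomm.eq, ← smul_eq_mul, ← map_smul, he]
  let θ : P →ₗ[A] D.left j := LinearMap.toSpanSingleton A (D.left j) (D.gen j) ∘ₗ φ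
  have hθ : Function.Surjective θ := h.surjective_of_ne_zero hsymm hrad fun h0 =>
    hφ (hφe.symm.trans (congrArg Subtype.val h0))
  exact ⟨LinearEquiv.ofBijective θ ⟨(LinearMap.injective_iff_surjective_of_finrank_eq_finrank
    (f := θ.restrictScalars K) hP).2 hθ, hθ⟩⟩

theorem exists_symm (h : D.IsBigenerator i j α) (hsymm : IsSymmetricAlgebraOver K A)
    (hper : IsIteratedSyzygy (ModuleCat.of A (D.Simple j)) 4 (ModuleCat.of A (D.Simple j))) :
    ∃ β, D.IsBigenerator j i β := by
  obtain ⟨L, hL, hLN⟩ := hper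
  obtain ⟨e⟩ := hL.nonempty_equiv (h.isIteratedSyzygy_radLeft hsymm)
  obtain ⟨P, ρ, hfin, ⟨hP, hρ, -⟩, ⟨f⟩⟩ := hLN.of_equiv e (LinearEquiv.refl A _)
  change P →ₗ[A] D.radLeft i at ρ
  change D.Simple j ≃ₗ[A] LinearMap.ker ρ at f
  let _ : Module K P := Module.compHom P (algebraMap K A)
  have : IsScalarTower K A P := IsScalarTower.of_algebraMap_smul fun _ _ => rfl
  have : FiniteDimensional K P := Module.Finite.trans A P
  have hdim : Module.finrank K P = Module.finrank K (D.left j) := by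
    have hker := finrank_eq_finrank_add_finrank_ker (K := K) hρ
    rw [hker, ← h.finrank_left_eq hsymm, D.finrank_left,
      ← (f.restrictScalars K).finrank_eq, D.finrank_simple]
  obtain ⟨g⟩ := h.nonempty_equiv_left hsymm hdim (f := (LinearMap.ker ρ).subtype ∘ₗ f.toLinearMap)
    (Subtype.val_injective.comp f.injective)
  have hpos : 0 < Module.finrank K (D.radLeft i) := by
    have hj : 0 < Module.finrank K (D.radLeft j) := by
      rw [D.finrank_radLeft_eq_finrank_range_mulRight h.mem_span_iff]
      exact Module.finrank_pos_iff_exists_ne_zero.2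
        ⟨⟨α, 1, one_mul α⟩, fun h0 => h.ne_zero (congrArg Subtype.val h0)⟩
    have hij := h.finrank_left_eq hsymm
    rw [D.finrank_left, D.finrank_left] at hij
    omega
  exact ⟨_, D.isBigenerator_of_surjective hsymm (h.finrank_left_eq hsymm) hpos
    (f := ρ ∘ₗ g.symm.toLinearMap) (hρ.comp g.symm.surjective)⟩

end IsBigenerator

end VertexSystem

section Orbit

open Polynomial

theorem exists_X_pow_dvd_mul_sub_X_pow {K : Type*} [Field K] {n : ℕ} {p : K[X]}
    (hp : ¬ X ^ n ∣ p) : ∃ h : K[X], X ^ n ∣ h * p - X ^ (n - 1) := by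
  have hp0 : p ≠ 0 := by
    rintro rfl
    exact hp (dvd_zero _)
  obtain ⟨q, hq, hq'⟩ := exists_eq_pow_rootMultiplicity_mul_and_not_dvd p hp0 0
  rw [C_0, sub_zero] at hq hq'
  set k := rootMultiplicity 0 p
  have hk : k < n := by
    by_contra hkn
    exact hp (hq ▸ Dvd.dvd.mul_right (pow_dvd_pow X (not_lt.1 hkn)) q)
  obtain ⟨u, v, huv⟩ : IsCoprime (X ^ n) q :=
    ((irreducible_X.coprime_iff_not_dvd).2 hq').pow_left
  have hX : (X : K[X]) ^ (n - 1) = X ^ (n - 1 - k) * X ^ k := by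
    rw [← pow_add, Nat.sub_add_cancel (by omega)]
  refine ⟨X ^ (n - 1 - k) * v, -(X ^ (n - 1) * u), ?_⟩
  linear_combination X ^ (n - 1 - k) * v * hq - v * q * hX + X ^ (n - 1) * huv

variable {K R M : Type*} [Field K] [Ring R] [Algebra K R] [AddCommGroup M] [Module R M]
  {t : R} {x : M} {n : ℕ} {p : K[X]}

theorem aeval_smul_eq_zero (hx : t ^ n • x = 0) (hp : X ^ n ∣ p) : aeval t p • x = 0 := by
  obtain ⟨q, rfl⟩ := hp
  rw [mul_comm, map_mul, map_pow, aeval_X, mul_smul, hx, smul_zero]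

theorem exists_aeval_smul_eq (hx : t ^ n • x = 0) (hp : ¬ X ^ n ∣ p) :
    ∃ h : K[X], aeval t h • aeval t p • x = t ^ (n - 1) • x := by
  obtain ⟨h, hh⟩ := exists_X_pow_dvd_mul_sub_X_pow hp
  refine ⟨h, ?_⟩
  have := aeval_smul_eq_zero hx hh
  rwa [map_sub, map_mul, map_pow, aeval_X, sub_smul, mul_smul, sub_eq_zero] at this

theorem X_pow_dvd_of_aeval_smul_eq_zero (hx : t ^ n • x = 0) (hx' : t ^ (n - 1) • x ≠ 0)
    (hp : aeval t p • x = 0) : X ^ n ∣ p := by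
  by_contra hnd
  obtain ⟨h, hh⟩ := exists_aeval_smul_eq hx hnd
  exact hx' (by rw [← hh, hp, smul_zero])

variable [Module K M] [IsScalarTower K R M] (g : Module.Dual K M)

theorem dual_aeval_smul_eq_zero (hg : ∀ k, g (t ^ k • x) = 0) (p : K[X]) :
    g (aeval t p • x) = 0 := by
  induction p using Polynomial.induction_on' with
  | add p q hp hq => rw [map_add, add_smul, map_add, hp, hq, add_zero]
  | monomial n a =>
    rw [aeval_monomial, mul_smul, algebraMap_smul, map_smul, hg, smul_zero]

theorem X_pow_dvd_of_dual_eq_zero (hx : t ^ n • x = 0) (hgx : g (t ^ (n - 1) • x) ≠ 0)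
    (hp : ∀ k, g (t ^ k • aeval t p • x) = 0) : X ^ n ∣ p := by
  by_contra hnd
  obtain ⟨h, hh⟩ := exists_aeval_smul_eq hx hnd
  exact hgx (hh ▸ dual_aeval_smul_eq_zero g hp h)

/-- A dimension count: the `n` values `g (t ^ k • y)`, `k < n`, are matched by a polynomial of
degree less than `n`. -/
theorem exists_aeval_smul_dual_eq (ht : ∀ y : M, t ^ n • y = 0)
    (hgx : g (t ^ (n - 1) • x) ≠ 0) (y : M) :
    ∃ p : K[X], ∀ k, g (t ^ k • (y - aeval t p • x)) = 0 := by
  let Φ : M →ₗ[K] (Fin n → K) := LinearMap.pi fun k => g ∘ₗ Algebra.lsmul K K M (t ^ (k : ℕ))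
  let Ψ : degreeLT K n →ₗ[K] M :=
    (LinearMap.toSpanSingleton R M x).restrictScalars K ∘ₗ
      (aeval t).toLinearMap ∘ₗ (degreeLT K n).subtype
  have hΦ : ∀ z, Φ z = 0 → ∀ k, g (t ^ k • z) = 0 := by
    intro z hz k
    by_cases hk : k < n
    · exact congrFun hz ⟨k, hk⟩
    · rw [← Nat.sub_add_cancel (not_lt.1 hk), pow_add, mul_smul, ht, smul_zero, map_zero]
  have hinj : Function.Injective (Φ ∘ₗ Ψ) := by
    refine (injective_iff_map_eq_zero _).2 fun p hp => Subtype.ext ?_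
    refine eq_zero_of_dvd_of_degree_lt (X_pow_dvd_of_dual_eq_zero g (ht x) hgx (hΦ _ hp)) ?_
    rw [degree_X_pow]
    exact mem_degreeLT.1 p.2
  have hfin : FiniteDimensional K (degreeLT K n) :=
    (degreeLTEquiv K n).symm.finiteDimensional
  obtain ⟨p, hp⟩ := (LinearMap.injective_iff_surjective_of_finrank_eq_finrank
    (degreeLTEquiv K n).finrank_eq).1 hinj (Φ y)
  refine ⟨p, hΦ _ ?_⟩
  rw [map_sub, ← hp]
  exact sub_self _

end Orbit

/-- The largest submodule contained in the kernel of a functional. -/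
def dualCore {K R M : Type*} [Field K] [Ring R] [AddCommGroup M] [Module R M] [Module K M]
    (g : Module.Dual K M) : Submodule R M where
  carrier := {y | ∀ r : R, g (r • y) = 0}
  add_mem' hx hy r := by rw [smul_add, map_add, hx r, hy r, add_zero]
  zero_mem' r := by rw [smul_zero, map_zero]
  smul_mem' s y hy r := by rw [← mul_smul, hy]

/-- A complete system of orthogonal idempotents and a nilpotent `t` permuting them which generate
the algebra: the shape of a Nakayama algebra whose quiver is a union of oriented cycles. -/
structure CyclicSystem (K R V : Type*) [Field K] [Ring R] [Algebra K R] [Fintype V] where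
  /-- the idempotents -/
  e : V → R
  /-- the sum of the arrows -/
  t : R
  /-- the map sending the source of each arrow to its target, as seen by `t` -/
  σ : V → V
  complete : CompleteOrthogonalIdempotents e
  t_mul_e : ∀ a, t * e a = e (σ a) * t
  exists_aeval : ∀ (r : R) (a : V), ∃ p : Polynomial K, r * e a = Polynomial.aeval t p * e a
  isNilpotent_t : IsNilpotent t

namespace CyclicSystem

open Polynomial

variable {K R V : Type*} [Field K] [Ring R] [Algebra K R] [Fintype V] (C : CyclicSystem K R V)

theorem t_pow_mul_e (k : ℕ) (a : V) : C.t ^ k * C.e a = C.e (C.σ^[k] a) * C.t ^ k := by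
  induction k with
  | zero => simp
  | succ k ih =>
    rw [pow_succ', mul_assoc, ih, ← mul_assoc, t_mul_e, mul_assoc, Function.iterate_succ_apply']

/-- The left ideal of relations of a generator at `a` of length `n`. -/
def relations (a : V) (n : ℕ) : Ideal R := Ideal.span {C.t ^ n * C.e a, 1 - C.e a}

section

variable {M : Type*} [AddCommGroup M] [Module R M] {x : M} {a : V} {n : ℕ}

theorem exists_aeval_smul (ha : C.e a • x = x) (r : R) :
    ∃ p : K[X], r * C.e a = aeval C.t p * C.e a ∧ r • x = aeval C.t p • x := by
  obtain ⟨p, hp⟩ := C.exists_aeval r a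
  refine ⟨p, hp, ?_⟩
  rw [← ha, ← mul_smul, hp, mul_smul]

theorem ker_toSpanSingleton (ha : C.e a • x = x) (hx : C.t ^ n • x = 0)
    (hx' : C.t ^ (n - 1) • x ≠ 0) :
    LinearMap.ker (LinearMap.toSpanSingleton R M x) = C.relations a n := by
  refine le_antisymm (fun r hr => ?_) (Ideal.span_le.2 ?_)
  · obtain ⟨p, hp, hpx⟩ := C.exists_aeval_smul ha r
    obtain ⟨q, rfl⟩ := X_pow_dvd_of_aeval_smul_eq_zero hx hx' (hpx.symm.trans hr)
    have hr_eq : r = aeval C.t q * (C.t ^ n * C.e a) + r * (1 - C.e a) := by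
      rw [mul_sub, hp, mul_comm (X ^ n), map_mul, map_pow, aeval_X, mul_one, mul_assoc,
        add_sub_cancel]
    rw [hr_eq]
    exact add_mem (Ideal.mul_mem_left _ _ (Ideal.subset_span (by simp)))
      (Ideal.mul_mem_left _ _ (Ideal.subset_span (by simp)))
  · rintro _ (rfl | rfl)
    · change (C.t ^ n * C.e a) • x = 0
      rw [mul_smul, ha, hx]
    · change (1 - C.e a) • x = 0
      rw [sub_smul, one_smul, ha, sub_self]

theorem exists_generator [Nontrivial M] : ∃ (a : V) (n : ℕ) (x : M), C.e a • x = x ∧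
    (∀ y : M, C.t ^ n • y = 0) ∧ C.t ^ (n - 1) • x ≠ 0 := by
  classical
  have hex : ∃ n, ∀ y : M, C.t ^ n • y = 0 := by
    obtain ⟨m, hm⟩ := C.isNilpotent_t
    exact ⟨m, fun y => by rw [hm, zero_smul]⟩
  have hpos : 0 < Nat.find hex := by
    refine (Nat.find_pos hex).2 fun h => ?_
    obtain ⟨y, hy⟩ := exists_ne (0 : M)
    exact hy (by simpa using h y)
  obtain ⟨y, hy⟩ := not_forall.1 (Nat.find_min hex (Nat.sub_lt hpos one_pos))
  obtain ⟨a, ha⟩ : ∃ a, C.t ^ (Nat.find hex - 1) • C.e a • y ≠ 0 := by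
    by_contra! hcon
    apply hy
    rw [← one_smul R y, ← C.complete.complete, Finset.sum_smul, Finset.smul_sum]
    exact Finset.sum_eq_zero fun a _ => hcon a
  exact ⟨a, _, C.e a • y, by rw [← mul_smul, C.complete.idem a], Nat.find_spec hex, ha⟩

variable [Module K M] [IsScalarTower K R M]

theorem mem_dualCore_of_t_pow {g : Module.Dual K M} {b : V}
    (hg : ∀ c, c ≠ b → ∀ y, g (C.e c • y) = 0) {y : M} (hy : ∀ k, g (C.t ^ k • y) = 0) :
    y ∈ dualCore (R := R) g := by
  have hgb : ∀ y, g (C.e b • y) = g y := by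
    intro y
    conv_rhs => rw [← one_smul R y, ← C.complete.complete, Finset.sum_smul, map_sum]
    exact (Finset.sum_eq_single b (fun c _ hc => hg c hc y) (by simp)).symm
  have hvertex : ∀ c k, g (C.t ^ k • C.e c • y) = 0 := by
    intro c k
    rw [← mul_smul, t_pow_mul_e, mul_smul]
    by_cases hc : C.σ^[k] c = b
    · rw [hc, hgb, hy]
    · exact hg _ hc _
  intro r
  choose p hp using fun c => C.exists_aeval r c
  rw [← mul_one r, ← C.complete.complete, Finset.mul_sum, Finset.sum_smul, map_sum]
  refine Finset.sum_eq_zero fun c _ => ?_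
  rw [hp, mul_smul]
  exact dual_aeval_smul_eq_zero g (hvertex c) (p c)

theorem exists_dual (ha : C.e a • x = x) (hx : C.t ^ (n - 1) • x ≠ 0) :
    ∃ (g : Module.Dual K M) (b : V), (∀ c, c ≠ b → ∀ y, g (C.e c • y) = 0) ∧
      g (C.t ^ (n - 1) • x) ≠ 0 := by
  set b := C.σ^[n - 1] a with hb
  obtain ⟨f, hf⟩ := not_forall.1
    ((Module.forall_dual_apply_eq_zero_iff K (C.t ^ (n - 1) • x)).not.2 hx)
  refine ⟨f ∘ₗ Algebra.lsmul K K M (C.e b), b, fun c hc y => ?_, ?_⟩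
  · change f (C.e b • C.e c • y) = 0
    rw [← mul_smul, C.complete.ortho hc.symm, zero_smul, map_zero]
  · change f (C.e b • C.t ^ (n - 1) • x) ≠ 0
    rwa [← mul_smul, hb, ← t_pow_mul_e, mul_smul, ha]

/-- An element `x` of maximal length generates a direct summand: a functional not vanishing on the
socle of `R x` gives a complement. -/
theorem exists_isCompl_range_toSpanSingleton (ha : C.e a • x = x)
    (ht : ∀ y : M, C.t ^ n • y = 0) (hx : C.t ^ (n - 1) • x ≠ 0) :
    ∃ N : Submodule R M, IsCompl (LinearMap.range (LinearMap.toSpanSingleton R M x)) N := by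
  obtain ⟨g, b, hg, hgx⟩ := C.exists_dual (K := K) ha hx
  refine ⟨dualCore g, disjoint_iff_inf_le.2 ?_, codisjoint_iff_le_sup.2 fun y _ => ?_⟩
  · rintro _ ⟨⟨r, rfl⟩, hr⟩
    obtain ⟨p, -, hp⟩ := C.exists_aeval_smul ha r
    rw [LinearMap.toSpanSingleton_apply, hp] at hr ⊢
    exact aeval_smul_eq_zero (ht x) (X_pow_dvd_of_dual_eq_zero g (ht x) hgx fun k => hr _)
  · obtain ⟨p, hp⟩ := exists_aeval_smul_dual_eq g ht hgx y
    exact Submodule.mem_sup.2 ⟨aeval C.t p • x, ⟨_, rfl⟩, _, C.mem_dualCore_of_t_pow hg hp,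
      add_sub_cancel _ _⟩

theorem exists_equiv_of_isIndecomposable (hM : IsIndecomposableModule R M) {m : ℕ}
    (hm : C.t ^ m = 0) : ∃ (a : V) (n : Fin (m + 1)), Nonempty (M ≃ₗ[R] R ⧸ C.relations a n) := by
  obtain ⟨hnt, hind⟩ := hM
  obtain ⟨a, n, x, ha, ht, hx⟩ := C.exists_generator (M := M)
  have hnm : n < m + 1 := by
    by_contra! hlt
    exact hx (by rw [← Nat.sub_add_cancel (show m ≤ n - 1 by omega), pow_add, hm, mul_zero,
      zero_smul])
  obtain ⟨N, hN⟩ := C.exists_isCompl_range_toSpanSingleton (K := K) ha ht hx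
  have hbot : LinearMap.range (LinearMap.toSpanSingleton R M x) ≠ ⊥ := by
    intro hbot
    have hx0 : x = 0 := (Submodule.eq_bot_iff _).1 hbot x ⟨1, one_smul R x⟩
    exact hx (by rw [hx0, smul_zero])
  have htop : LinearMap.range (LinearMap.toSpanSingleton R M x) = ⊤ := by
    simpa [(hind _ N hN).resolve_left hbot] using hN.sup_eq_top
  refine ⟨a, ⟨n, hnm⟩, ⟨?_⟩⟩
  rw [← C.ker_toSpanSingleton ha (ht x) hx]
  exact (LinearMap.quotKerEquivOfSurjective _ (LinearMap.range_eq_top.1 htop)).symm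

end

theorem isFiniteRepType {K V : Type*} {A : Type u} [Field K] [Ring A] [Algebra K A] [Fintype V]
    (C : CyclicSystem K Aᵐᵒᵖ V) : IsFiniteRepType A := by
  obtain ⟨m, hm⟩ := C.isNilpotent_t
  let ε := Fintype.equivFin (V × Fin (m + 1))
  refine ⟨_, fun k => ModuleCat.of Aᵐᵒᵖ (Aᵐᵒᵖ ⧸ C.relations (ε.symm k).1 (ε.symm k).2),
    fun M _ hM => ?_⟩
  let _ : Module K M := Module.compHom M (algebraMap K Aᵐᵒᵖ)
  have : IsScalarTower K Aᵐᵒᵖ M := IsScalarTower.of_algebraMap_smul fun _ _ => rfl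
  obtain ⟨a, n, hf⟩ := C.exists_equiv_of_isIndecomposable hM hm
  obtain ⟨k, hk⟩ := ε.symm.surjective (a, n)
  refine ⟨k, ?_⟩
  change Nonempty (M ≃ₗ[Aᵐᵒᵖ] Aᵐᵒᵖ ⧸ C.relations (ε.symm k).1 (ε.symm k).2)
  rwa [hk]

end CyclicSystem

namespace PathAlgebra

open Quiver

/-- The type of all paths of a quiver, a path being packed with its endpoints. -/
abbrev AnyPath (V : Type*) [Quiver V] := Σ a b : V, Path a b

namespace AnyPath

variable {V : Type*} [Quiver V]

/-- The trivial path at a vertex. -/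
abbrev nil (a : V) : AnyPath V := ⟨a, a, Path.nil⟩

/-- An arrow as a path. -/
abbrev arrow {a b : V} (f : a ⟶ b) : AnyPath V := ⟨a, b, f.toPath⟩

/-- The number of arrows of a path. -/
abbrev length (s : AnyPath V) : ℕ := s.2.2.length

theorem nil_injective : Function.Injective (nil : V → AnyPath V) := fun _ _ h =>
  congrArg Sigma.fst h

theorem ne_nil_of_length_pos {s : AnyPath V} (hs : 0 < s.length) (a : V) : s ≠ nil a := by
  rintro rfl
  exact hs.ne' rfl

theorem star_mk_eq_of_arrow_eq {a b c : V} {f : a ⟶ b} {g : a ⟶ c} (h : arrow f = arrow g) :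
    Quiver.Star.mk f = Quiver.Star.mk g := by
  cases h
  rfl

theorem costar_mk_eq_of_arrow_eq {a b c : V} {f : a ⟶ c} {g : b ⟶ c} (h : arrow f = arrow g) :
    Costar.mk f = Costar.mk g := by
  cases h
  rfl

theorem finite_setOf_length_eq [Finite V] [∀ a b : V, Finite (a ⟶ b)] (n : ℕ) :
    {s : AnyPath V | s.length = n}.Finite := by
  induction n with
  | zero =>
    refine (Set.finite_range (nil : V → AnyPath V)).subset ?_
    rintro ⟨a, b, p⟩ hp
    obtain rfl := p.eq_of_length_zero hp
    exact ⟨a, by rw [p.eq_nil_of_length_zero hp]⟩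
  | succ n ih =>
    have := ih.to_subtype
    let extend : (Σ s : {s : AnyPath V | s.length = n}, Quiver.Star s.1.2.1) → AnyPath V :=
      fun x => ⟨x.1.1.1, x.2.1, x.1.1.2.2.cons x.2.2⟩
    refine (Set.finite_range extend).subset ?_
    rintro ⟨a, b, p⟩ hp
    cases p with
    | nil => exact absurd hp (Nat.succ_ne_zero n).symm
    | cons p f => exact ⟨⟨⟨⟨_, _, p⟩, Nat.succ_injective hp⟩, Quiver.Star.mk f⟩, rfl⟩

end AnyPath

section Basis

variable (K : Type u) (V : Type v) [Quiver.{w} V] [Field K]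

/-- The basis of the path algebra given by the paths. -/
noncomputable def pathBasis [Finite V] : Module.Basis (AnyPath V) K (PathAlgebra K V) :=
  haveI := Fintype.ofFinite V
  Pi.basis fun _ => Pi.basis fun _ => Finsupp.basisSingleOne

variable {V} [Finite V]

theorem pathBasis_repr (x : PathAlgebra K V) (s : AnyPath V) :
    (pathBasis K V).repr x s = x s.1 s.2.1 s.2.2 := rfl

theorem pathBasis_apply_self {a b : V} (p : Path a b) :
    pathBasis K V ⟨a, b, p⟩ a b = Finsupp.single p 1 := by
  classical
  ext q
  rw [← pathBasis_repr K _ ⟨a, b, q⟩]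
  simp [Finsupp.single_apply]

theorem pathBasis_apply_of_ne {s : AnyPath V} {a b : V} (h : s.1 ≠ a ∨ s.2.1 ≠ b) :
    pathBasis K V s a b = 0 := by
  ext q
  rw [← pathBasis_repr K _ ⟨a, b, q⟩, Module.Basis.repr_self, Finsupp.single_eq_of_ne]
  · rfl
  · rintro rfl
    simp at h

theorem coord_nil_pathBasis_nil [DecidableEq V] (a b : V) :
    (pathBasis K V).coord (AnyPath.nil a) (pathBasis K V (AnyPath.nil b)) =
      if a = b then 1 else 0 := by
  rw [Module.Basis.coord_apply, Module.Basis.repr_self]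
  split_ifs with h
  · rw [h, Finsupp.single_eq_same]
  · rw [Finsupp.single_eq_of_ne (AnyPath.nil_injective.ne h)]

theorem coord_nil_pathBasis_of_length_pos (a : V) {s : AnyPath V} (hs : 0 < s.length) :
    (pathBasis K V).coord (AnyPath.nil a) (pathBasis K V s) = 0 := by
  rw [Module.Basis.coord_apply, Module.Basis.repr_self,
    Finsupp.single_eq_of_ne (AnyPath.ne_nil_of_length_pos hs a).symm]

end Basis

variable {K : Type u} {V : Type v} [Quiver.{w} V] [Field K] [Fintype V]

theorem pathBasis_mul {a b c : V} (p : Path a b) (q : Path b c) :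
    pathBasis K V ⟨a, b, p⟩ * pathBasis K V ⟨b, c, q⟩ = pathBasis K V ⟨a, c, p.comp q⟩ := by
  classical
  funext x y
  rw [mul_apply, Finset.sum_eq_single b (fun d _ hd => ?_) (by simp)]
  · by_cases hx : a = x
    · by_cases hy : c = y
      · subst hx hy
        rw [pathBasis_apply_self, pathBasis_apply_self, pathBasis_apply_self, concat_single,
          mul_one]
      · rw [pathBasis_apply_of_ne K (s := ⟨b, c, q⟩) (Or.inr hy),
          pathBasis_apply_of_ne K (s := ⟨a, c, p.comp q⟩) (Or.inr hy), map_zero]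
    · rw [pathBasis_apply_of_ne K (s := ⟨a, b, p⟩) (Or.inl hx),
        pathBasis_apply_of_ne K (s := ⟨a, c, p.comp q⟩) (Or.inl hx), map_zero,
        LinearMap.zero_apply]
  · rw [pathBasis_apply_of_ne K (Or.inr hd.symm), map_zero, LinearMap.zero_apply]

theorem pathBasis_mul_of_ne [DecidableEq V] {s t : AnyPath V} (h : s.2.1 ≠ t.1) :
    pathBasis K V s * pathBasis K V t = 0 := by
  funext x y
  rw [mul_apply]
  refine Finset.sum_eq_zero fun d _ => ?_
  by_cases hd : s.2.1 = d
  · rw [pathBasis_apply_of_ne K (s := t) (Or.inl fun ht => h (hd.trans ht.symm)), map_zero]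
  · rw [pathBasis_apply_of_ne K (Or.inr hd), map_zero, LinearMap.zero_apply]

theorem coord_nil_mul_pathBasis (a : V) (s t : AnyPath V) :
    (pathBasis K V).coord (AnyPath.nil a) (pathBasis K V s * pathBasis K V t) =
      (pathBasis K V).coord (AnyPath.nil a) (pathBasis K V s) *
        (pathBasis K V).coord (AnyPath.nil a) (pathBasis K V t) := by
  classical
  obtain ⟨b, c, p⟩ := s
  obtain ⟨d, e, q⟩ := t
  cases p with
  | cons p f =>
    rw [coord_nil_pathBasis_of_length_pos K a (s := ⟨b, _, p.cons f⟩) (Nat.succ_pos _),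
      zero_mul]
    by_cases h : c = d
    · subst h
      rw [pathBasis_mul, coord_nil_pathBasis_of_length_pos K a]
      simp [AnyPath.length]
    · rw [pathBasis_mul_of_ne h, map_zero]
  | nil =>
    by_cases h : b = d
    · subst h
      rw [pathBasis_mul, Path.nil_comp]
      cases q with
      | cons q g =>
        rw [coord_nil_pathBasis_of_length_pos K a (s := ⟨b, _, q.cons g⟩) (Nat.succ_pos _),
          mul_zero]
      | nil =>
        rw [coord_nil_pathBasis_nil K a b]
        split_ifs <;> simp
    · rw [pathBasis_mul_of_ne h, map_zero]
      cases q with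
      | cons q g =>
        rw [coord_nil_pathBasis_of_length_pos K a (s := ⟨d, _, q.cons g⟩) (Nat.succ_pos _),
          mul_zero]
      | nil =>
        rw [coord_nil_pathBasis_nil K a b, coord_nil_pathBasis_nil K a d]
        by_cases hb : a = b
        · rw [if_neg fun hd => h (hb.symm.trans hd), mul_zero]
        · rw [if_neg hb, zero_mul]

variable [DecidableEq V]

theorem one_eq_sum_pathBasis : (1 : PathAlgebra K V) = ∑ a, pathBasis K V (AnyPath.nil a) := by
  refine (pathBasis K V).ext_elem fun ⟨a, b, p⟩ => ?_
  rw [map_sum, Finset.sum_apply', Finset.sum_eq_single a (fun c _ hc => ?_) (by simp),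
    pathBasis_repr, pathBasis_repr]
  · by_cases h : b = a
    · subst h
      rw [one_apply_self, pathBasis_apply_self]
    · rw [one_apply_ne h, pathBasis_apply_of_ne K (Or.inr (Ne.symm h))]
  · rw [pathBasis_repr, pathBasis_apply_of_ne K (Or.inl hc)]
    rfl

/-- The augmentation at a vertex: the coefficient of the trivial path. -/
noncomputable def augmentation (a : V) : PathAlgebra K V →ₐ[K] K :=
  AlgHom.ofLinearMap ((pathBasis K V).coord (AnyPath.nil a))
    (by
      rw [one_eq_sum_pathBasis, map_sum]
      simp only [coord_nil_pathBasis_nil, Finset.sum_ite_eq, Finset.mem_univ, if_true])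
    (fun x y => by
      have h : (LinearMap.mul K (PathAlgebra K V)).compr₂
          ((pathBasis K V).coord (AnyPath.nil a)) =
          (LinearMap.mul K K).compl₁₂ ((pathBasis K V).coord (AnyPath.nil a))
            ((pathBasis K V).coord (AnyPath.nil a)) :=
        LinearMap.ext_basis (pathBasis K V) (pathBasis K V) (coord_nil_mul_pathBasis a)
      exact LinearMap.congr_fun₂ h x y)

theorem augmentation_pathBasis_nil (a b : V) :
    augmentation a (pathBasis K V (AnyPath.nil b)) = if a = b then 1 else 0 :=
  coord_nil_pathBasis_nil K a b

theorem augmentation_pathBasis_of_length_pos (a : V) {s : AnyPath V} (hs : 0 < s.length) :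
    augmentation a (pathBasis K V s) = 0 :=
  coord_nil_pathBasis_of_length_pos K a hs

theorem IsAdmissible.repr_eq_zero {I : Ideal (PathAlgebra K V)} (hI : IsAdmissible I)
    {x : PathAlgebra K V} (hx : x ∈ I) {s : AnyPath V} (hs : s.length < 2) :
    (pathBasis K V).repr x s = 0 := by
  by_contra h
  exact hs.not_ge (hI.1 hx s.1 s.2.1 s.2.2 (Finsupp.mem_support_iff.2 h))

section PathSpan

variable (I : Ideal (PathAlgebra K V)) [I.IsTwoSided]

/-- The class of a path in the quotient by `I`. -/
noncomputable def cls (s : AnyPath V) : PathAlgebra K V ⧸ I :=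
  Ideal.Quotient.mkₐ K I (pathBasis K V s)

/-- The span of the classes of the paths of length at least `n`: the `n`-th power of the arrow
ideal of the quotient by `I`. -/
noncomputable def pathSpan (n : ℕ) : Submodule K (PathAlgebra K V ⧸ I) :=
  Submodule.span K (cls I '' {s | n ≤ s.length})

variable {I}

theorem cls_mul_cls {a b c : V} (p : Path a b) (q : Path b c) :
    cls I ⟨a, b, p⟩ * cls I ⟨b, c, q⟩ = cls I ⟨a, c, p.comp q⟩ := by
  rw [cls, cls, ← map_mul, pathBasis_mul, cls]

theorem cls_mul_cls_of_ne {s t : AnyPath V} (h : s.2.1 ≠ t.1) : cls I s * cls I t = 0 := by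
  rw [cls, cls, ← map_mul, pathBasis_mul_of_ne h, map_zero]

theorem cls_nil_mul (s : AnyPath V) : cls I (AnyPath.nil s.1) * cls I s = cls I s := by
  rw [cls_mul_cls, Path.nil_comp]

theorem cls_mul_nil (s : AnyPath V) : cls I s * cls I (AnyPath.nil s.2.1) = cls I s := by
  rw [cls_mul_cls, Path.comp_nil]

theorem completeOrthogonalIdempotents_cls_nil :
    CompleteOrthogonalIdempotents fun a : V => cls I (AnyPath.nil a) where
  idem a := cls_nil_mul (AnyPath.nil a)
  ortho _ _ h := cls_mul_cls_of_ne h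
  complete := by
    simp only [cls]
    rw [← map_sum, ← one_eq_sum_pathBasis, map_one]

theorem cls_mem_pathSpan {n : ℕ} {s : AnyPath V} (h : n ≤ s.length) : cls I s ∈ pathSpan I n :=
  Submodule.subset_span ⟨s, h, rfl⟩

theorem span_range_cls : Submodule.span K (Set.range (cls I)) = ⊤ := by
  change Submodule.span K (Set.range ((Ideal.Quotient.mkₐ K I).toLinearMap ∘ pathBasis K V)) = ⊤
  rw [Set.range_comp, ← Submodule.map_span, Module.Basis.span_eq, Submodule.map_top,
    LinearMap.range_eq_top]
  exact Ideal.Quotient.mkₐ_surjective K I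

theorem mem_of_cls_mem {S : Submodule K (PathAlgebra K V ⧸ I)} (h : ∀ s, cls I s ∈ S)
    (x : PathAlgebra K V ⧸ I) : x ∈ S :=
  Submodule.span_le.2 (Set.range_subset_iff.2 h) (span_range_cls.ge (Submodule.mem_top (x := x)))

theorem pathSpan_mul_le (m n : ℕ) : pathSpan I m * pathSpan I n ≤ pathSpan I (m + n) := by
  rw [pathSpan, pathSpan, Submodule.span_mul_span, Submodule.span_le]
  rintro _ ⟨_, ⟨⟨a, b, p⟩, hp, rfl⟩, _, ⟨⟨c, d, q⟩, hq, rfl⟩, rfl⟩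
  change cls I _ * cls I _ ∈ pathSpan I (m + n)
  by_cases h : b = c
  · subst h
    rw [cls_mul_cls]
    exact cls_mem_pathSpan ((add_le_add hp hq).trans (Path.length_comp p q).ge)
  · rw [cls_mul_cls_of_ne h]
    exact zero_mem _

theorem mul_mem_pathSpan_two {x y : PathAlgebra K V ⧸ I} (hx : x ∈ pathSpan I 1)
    (hy : y ∈ pathSpan I 1) : x * y ∈ pathSpan I 2 :=
  pathSpan_mul_le 1 1 (Submodule.mul_mem_mul hx hy)

theorem pow_mem_pathSpan {x : PathAlgebra K V ⧸ I} (hx : x ∈ pathSpan I 1) (k : ℕ) :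
    x ^ k ∈ pathSpan I k := by
  induction k with
  | zero => exact mem_of_cls_mem (fun _ => cls_mem_pathSpan (Nat.zero_le _)) _
  | succ k ih => exact pow_succ x k ▸ pathSpan_mul_le k 1 (Submodule.mul_mem_mul ih hx)

theorem pathSpan_eq_bot {m : ℕ} (hm : arrowIdealPow K V m ⊆ (I : Set (PathAlgebra K V))) :
    pathSpan I m = ⊥ := by
  rw [pathSpan, Submodule.span_eq_bot]
  rintro _ ⟨s, hs, rfl⟩
  refine Ideal.Quotient.eq_zero_iff_mem.2 (hm fun a b p hp => ?_)
  have h := Finsupp.mem_support_iff.1 hp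
  rw [← pathBasis_repr K _ ⟨a, b, p⟩, Module.Basis.repr_self] at h
  obtain rfl : ⟨a, b, p⟩ = s := by
    by_contra hne
    exact h (Finsupp.single_eq_of_ne hne)
  exact hs

theorem mul_nil_mem {S : Submodule K (PathAlgebra K V ⧸ I)} {j : V}
    (hS : ∀ y a (f : a ⟶ j), y * cls I (AnyPath.arrow f) ∈ S) {x : PathAlgebra K V ⧸ I}
    (hx : x ∈ pathSpan I 1) : x * cls I (AnyPath.nil j) ∈ S := by
  suffices pathSpan I 1 ≤ S.comap (LinearMap.mulRight K (cls I (AnyPath.nil j))) from this hx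
  rw [pathSpan, Submodule.span_le]
  rintro _ ⟨⟨a, b, p⟩, hp, rfl⟩
  change cls I ⟨a, b, p⟩ * cls I (AnyPath.nil j) ∈ S
  by_cases hb : b = j
  · subst hb
    rw [cls_mul_nil ⟨a, b, p⟩]
    cases p with
    | nil => exact absurd hp (by simp [AnyPath.length])
    | cons p f => exact cls_mul_cls (I := I) p f.toPath ▸ hS _ _ f
  · rw [cls_mul_cls_of_ne hb]
    exact zero_mem S

theorem nil_mul_mem {S : Submodule K (PathAlgebra K V ⧸ I)} {i : V}
    (hS : ∀ y a (f : i ⟶ a), cls I (AnyPath.arrow f) * y ∈ S) {x : PathAlgebra K V ⧸ I}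
    (hx : x ∈ pathSpan I 1) : cls I (AnyPath.nil i) * x ∈ S := by
  suffices pathSpan I 1 ≤ S.comap (LinearMap.mulLeft K (cls I (AnyPath.nil i))) from this hx
  rw [pathSpan, Submodule.span_le]
  rintro _ ⟨⟨a, b, p⟩, hp, rfl⟩
  change cls I (AnyPath.nil i) * cls I ⟨a, b, p⟩ ∈ S
  by_cases ha : i = a
  · subst ha
    rw [cls_nil_mul ⟨i, b, p⟩]
    obtain ⟨c, f, q, rfl, -⟩ := (Path.length_ne_zero_iff_eq_comp p).1 (Nat.pos_iff_ne_zero.1 hp)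
    exact cls_mul_cls (I := I) f.toPath q ▸ hS _ _ f
  · rw [cls_mul_cls_of_ne ha]
    exact zero_mem S

end PathSpan

variable {I : Ideal (PathAlgebra K V)} [I.IsTwoSided]

namespace IsAdmissible

theorem finiteDimensional [∀ a b : V, Finite (a ⟶ b)] (hI : IsAdmissible I) :
    FiniteDimensional K (PathAlgebra K V ⧸ I) := by
  obtain ⟨m, -, hm⟩ := hI.2
  have hfin : {s : AnyPath V | s.length < m}.Finite :=
    ((Set.finite_Iio m).biUnion fun n _ => AnyPath.finite_setOf_length_eq n).subset fun s hs =>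
      Set.mem_biUnion hs rfl
  refine Module.Finite.of_fg_top (Submodule.fg_def.2 ⟨_, hfin.image (cls I), ?_⟩)
  refine eq_top_iff.2 fun x _ => mem_of_cls_mem (fun s => ?_) x
  rcases lt_or_ge s.length m with hs | hs
  · exact Submodule.subset_span ⟨s, hs, rfl⟩
  · have h := cls_mem_pathSpan (I := I) hs
    rw [pathSpan_eq_bot hm, Submodule.mem_bot] at h
    exact h ▸ zero_mem _

/-- The character of the quotient by `I` induced by the augmentation at a vertex. -/
noncomputable def χ (hI : IsAdmissible I) (a : V) : PathAlgebra K V ⧸ I →ₐ[K] K :=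
  Ideal.Quotient.liftₐ I (augmentation a) fun _ hx =>
    hI.repr_eq_zero (s := AnyPath.nil a) hx two_pos

theorem χ_cls_nil (hI : IsAdmissible I) (a b : V) :
    hI.χ a (cls I (AnyPath.nil b)) = if a = b then 1 else 0 :=
  augmentation_pathBasis_nil a b

theorem χ_cls_of_length_pos (hI : IsAdmissible I) (a : V) {s : AnyPath V} (hs : 0 < s.length) :
    hI.χ a (cls I s) = 0 :=
  augmentation_pathBasis_of_length_pos a hs

theorem mem_pathSpan_one (hI : IsAdmissible I) {x : PathAlgebra K V ⧸ I}
    (hx : ∀ a, hI.χ a x = 0) : x ∈ pathSpan I 1 := by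
  let F : PathAlgebra K V ⧸ I →ₗ[K] PathAlgebra K V ⧸ I :=
    LinearMap.id - ∑ a, (hI.χ a).toLinearMap.smulRight (cls I (AnyPath.nil a))
  have hF (y) : F y = y - ∑ a, hI.χ a y • cls I (AnyPath.nil a) := by simp [F]
  suffices h : x ∈ (pathSpan I 1).comap F by
    rw [Submodule.mem_comap, hF, Finset.sum_eq_zero fun a _ => by rw [hx, zero_smul],
      sub_zero] at h
    exact h
  refine mem_of_cls_mem (fun s => ?_) x
  rw [Submodule.mem_comap, hF]
  obtain ⟨b, c, p⟩ := s
  cases p with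
  | nil =>
    simp only [hI.χ_cls_nil, ite_smul, one_smul, zero_smul, Finset.sum_ite_eq', Finset.mem_univ,
      if_true, sub_self, zero_mem]
  | cons p f =>
    have hpos : 0 < AnyPath.length ⟨b, c, p.cons f⟩ := Nat.succ_pos _
    rw [Finset.sum_eq_zero fun a _ => by rw [hI.χ_cls_of_length_pos a hpos, zero_smul], sub_zero]
    exact cls_mem_pathSpan hpos

/-- The vertex idempotents and characters of an admissible quotient of a path algebra. -/
noncomputable def vertexSystem (hI : IsAdmissible I) :
    VertexSystem K (PathAlgebra K V ⧸ I) V where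
  e a := cls I (AnyPath.nil a)
  χ := hI.χ
  complete := completeOrthogonalIdempotents_cls_nil
  χ_e_self a := (hI.χ_cls_nil a a).trans (if_pos rfl)
  isNilpotent x hx := by
    obtain ⟨m, -, hm⟩ := hI.2
    exact ⟨m, (Submodule.mem_bot K).1
      (pathSpan_eq_bot hm ▸ pow_mem_pathSpan (hI.mem_pathSpan_one hx) m)⟩

theorem mem_pathSpan_of_mem_rad (hI : IsAdmissible I) {x : PathAlgebra K V ⧸ I}
    (hx : x ∈ hI.vertexSystem.rad) : x ∈ pathSpan I 1 :=
  hI.mem_pathSpan_one (hI.vertexSystem.mem_rad.1 hx)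

theorem cls_mem_rad (hI : IsAdmissible I) {s : AnyPath V} (hs : 0 < s.length) :
    cls I s ∈ hI.vertexSystem.rad :=
  hI.vertexSystem.mem_rad.2 fun a => hI.χ_cls_of_length_pos a hs

theorem repr_eq_zero_of_mk_mem_pathSpan (hI : IsAdmissible I) {y : PathAlgebra K V}
    (hy : Ideal.Quotient.mkₐ K I y ∈ pathSpan I 2) {s : AnyPath V} (hs : s.length < 2) :
    (pathBasis K V).repr y s = 0 := by
  have hmap : pathSpan I 2 = (Submodule.span K (pathBasis K V '' {s | 2 ≤ s.length})).map
      (Ideal.Quotient.mkₐ K I).toLinearMap := by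
    rw [Submodule.map_span, Set.image_image]
    rfl
  rw [hmap] at hy
  obtain ⟨z, hz, hzy⟩ := hy
  have hzs : (pathBasis K V).repr z s = 0 := by
    by_contra h
    exact hs.not_ge ((pathBasis K V).mem_span_image.1 hz (Finsupp.mem_support_iff.2 h))
  have hsub := hI.repr_eq_zero (Ideal.Quotient.eq.1 hzy) hs
  rwa [map_sub, Finsupp.sub_apply, hzs, zero_sub, neg_eq_zero] at hsub

theorem cls_notMem_pathSpan_two (hI : IsAdmissible I) {s : AnyPath V} (hs : s.length < 2) :
    cls I s ∉ pathSpan I 2 := fun h => by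
  have := hI.repr_eq_zero_of_mk_mem_pathSpan h hs
  rw [Module.Basis.repr_self, Finsupp.single_eq_same] at this
  exact one_ne_zero this

theorem eq_of_cls_sub_smul_mem_pathSpan_two (hI : IsAdmissible I) {s t : AnyPath V}
    (hs : s.length < 2) {c : K} (h : cls I s - c • cls I t ∈ pathSpan I 2) : s = t := by
  by_contra hst
  have := hI.repr_eq_zero_of_mk_mem_pathSpan (y := pathBasis K V s - c • pathBasis K V t)
    (by rwa [map_sub, map_smul]) hs
  rw [map_sub, map_smul, Module.Basis.repr_self, Module.Basis.repr_self, Finsupp.sub_apply,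
    Finsupp.smul_apply, Finsupp.single_eq_same, Finsupp.single_eq_of_ne hst, smul_zero,
    sub_zero] at this
  exact one_ne_zero this

theorem isBigenerator (hI : IsAdmissible I) {i j : V} (α : i ⟶ j)
    (hout : ∀ s : Quiver.Star i, s = Quiver.Star.mk α) (hin : ∀ s : Costar j, s = Costar.mk α) :
    hI.vertexSystem.IsBigenerator i j (cls I (AnyPath.arrow α)) where
  ne_zero h := hI.cls_notMem_pathSpan_two (s := AnyPath.arrow α) one_lt_two (h ▸ zero_mem _)
  mem_span_iff x := by
    rw [Ideal.mem_span_singleton']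
    constructor
    · rintro ⟨y, rfl⟩
      exact ⟨(mul_assoc _ _ _).trans (congrArg (y * ·) (cls_mul_nil (AnyPath.arrow α))),
        Ideal.mul_mem_left _ y (hI.cls_mem_rad one_pos)⟩
    · rintro ⟨hxj, hx⟩
      rw [← hxj]
      refine mul_nil_mem (S := LinearMap.range (LinearMap.mulRight K (cls I (AnyPath.arrow α))))
        (fun y a f => ?_) (hI.mem_pathSpan_of_mem_rad hx)
      cases hin (Costar.mk f)
      exact ⟨y, rfl⟩
  dvd_iff x := by
    constructor
    · rintro ⟨y, rfl⟩
      exact ⟨(mul_assoc _ _ _).symm.trans (congrArg (· * y) (cls_nil_mul (AnyPath.arrow α))),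
        Ideal.mul_mem_right y _ (hI.cls_mem_rad one_pos)⟩
    · rintro ⟨hxi, hx⟩
      rw [← hxi]
      suffices cls I (AnyPath.nil i) * x ∈
          LinearMap.range (LinearMap.mulLeft K (cls I (AnyPath.arrow α))) by
        obtain ⟨y, hy⟩ := this
        exact ⟨y, hy.symm⟩
      refine nil_mul_mem (fun y a f => ?_) (hI.mem_pathSpan_of_mem_rad hx)
      cases hout (Quiver.Star.mk f)
      exact ⟨y, rfl⟩

theorem mul_sub_smul_mem_of_nil_mul (hI : IsAdmissible I) {a : V} {x : PathAlgebra K V ⧸ I}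
    (hx : x ∈ pathSpan I 1) (hax : cls I (AnyPath.nil a) * x = x) (y : PathAlgebra K V ⧸ I) :
    y * x - hI.χ a y • x ∈ pathSpan I 2 := by
  have hz : (y - algebraMap K _ (hI.χ a y)) * cls I (AnyPath.nil a) ∈ pathSpan I 1 := by
    refine hI.mem_pathSpan_one fun b => ?_
    rw [map_mul, map_sub, AlgHom.commutes, hI.χ_cls_nil, Algebra.algebraMap_self_apply]
    split_ifs with hb
    · rw [hb, sub_self, zero_mul]
    · rw [mul_zero]
  have := mul_mem_pathSpan_two hz hx
  rwa [mul_assoc, hax, sub_mul, ← Algebra.smul_def] at this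

theorem mul_sub_smul_mem_of_mul_nil (hI : IsAdmissible I) {a : V} {x : PathAlgebra K V ⧸ I}
    (hx : x ∈ pathSpan I 1) (hxa : x * cls I (AnyPath.nil a) = x) (y : PathAlgebra K V ⧸ I) :
    x * y - hI.χ a y • x ∈ pathSpan I 2 := by
  have hz : cls I (AnyPath.nil a) * (y - algebraMap K _ (hI.χ a y)) ∈ pathSpan I 1 := by
    refine hI.mem_pathSpan_one fun b => ?_
    rw [map_mul, map_sub, AlgHom.commutes, hI.χ_cls_nil, Algebra.algebraMap_self_apply]
    split_ifs with hb
    · rw [hb, sub_self, mul_zero]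
    · rw [zero_mul]
  have := mul_mem_pathSpan_two hx hz
  rwa [← mul_assoc, hxa, mul_sub, ← Algebra.commutes, ← Algebra.smul_def] at this

section Bigenerator

variable {i j : V} {β : PathAlgebra K V ⧸ I}

theorem exists_cls_sub_smul_mem (hI : IsAdmissible I) (h : hI.vertexSystem.IsBigenerator j i β)
    {s : AnyPath V} (hs : 0 < s.length) (hji : s.1 = j ∨ s.2.1 = i) :
    ∃ c : K, cls I s - c • β ∈ pathSpan I 2 := by
  have hβ := hI.mem_pathSpan_of_mem_rad h.mem_rad
  rcases hji with rfl | rfl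
  · obtain ⟨y, hy⟩ := (h.dvd_iff (cls I s)).2 ⟨cls_nil_mul s, hI.cls_mem_rad hs⟩
    exact ⟨_, hy ▸ hI.mul_sub_smul_mem_of_mul_nil hβ h.mul_e y⟩
  · obtain ⟨y, hy⟩ := Ideal.mem_span_singleton'.1
      ((h.mem_span_iff (cls I s)).2 ⟨cls_mul_nil s, hI.cls_mem_rad hs⟩)
    exact ⟨_, hy ▸ hI.mul_sub_smul_mem_of_nil_mul hβ h.e_mul y⟩

theorem eq_of_length_eq_one (hI : IsAdmissible I) (h : hI.vertexSystem.IsBigenerator j i β)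
    {s t : AnyPath V} (hs : s.length = 1) (hsji : s.1 = j ∨ s.2.1 = i) (ht : t.length = 1)
    (htji : t.1 = j ∨ t.2.1 = i) : s = t := by
  obtain ⟨c, hc⟩ := hI.exists_cls_sub_smul_mem h (hs ▸ one_pos) hsji
  obtain ⟨d, hd⟩ := hI.exists_cls_sub_smul_mem h (ht ▸ one_pos) htji
  have hd0 : d ≠ 0 := by
    rintro rfl
    rw [zero_smul, sub_zero] at hd
    exact hI.cls_notMem_pathSpan_two (ht ▸ one_lt_two) hd
  refine hI.eq_of_cls_sub_smul_mem_pathSpan_two (c := c / d) (hs ▸ one_lt_two) ?_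
  convert sub_mem hc (Submodule.smul_mem _ (c / d) hd) using 1
  rw [smul_sub, smul_smul, div_mul_cancel₀ c hd0, sub_sub_sub_cancel_right]

theorem nonempty_costar (hI : IsAdmissible I) (h : hI.vertexSystem.IsBigenerator j i β) :
    Nonempty (Costar i) := by
  by_contra hempty
  refine h.ne_zero (h.mul_e.symm.trans ?_)
  exact (Submodule.mem_bot K).1 (mul_nil_mem (fun _ _ f => absurd ⟨Costar.mk f⟩ hempty)
    (hI.mem_pathSpan_of_mem_rad h.mem_rad))

theorem nonempty_star (hI : IsAdmissible I) (h : hI.vertexSystem.IsBigenerator j i β) :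
    Nonempty (Quiver.Star j) := by
  by_contra hempty
  refine h.ne_zero (h.e_mul.symm.trans ?_)
  exact (Submodule.mem_bot K).1 (nil_mul_mem (fun _ _ f => absurd ⟨Quiver.Star.mk f⟩ hempty)
    (hI.mem_pathSpan_of_mem_rad h.mem_rad))

theorem exists_unique_arrow (hI : IsAdmissible I) (h : hI.vertexSystem.IsBigenerator j i β) :
    ∃ γ : j ⟶ i, (∀ s : Quiver.Star j, s = Quiver.Star.mk γ) ∧
      ∀ s : Costar i, s = Costar.mk γ := by
  obtain ⟨a, γ⟩ := hI.nonempty_costar h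
  obtain ⟨b, δ⟩ := hI.nonempty_star h
  obtain rfl : a = j := congrArg Sigma.fst (hI.eq_of_length_eq_one h (s := AnyPath.arrow γ)
    (t := AnyPath.arrow δ) rfl (Or.inr rfl) rfl (Or.inl rfl))
  exact ⟨γ,
    fun s => AnyPath.star_mk_eq_of_arrow_eq
      (hI.eq_of_length_eq_one h rfl (Or.inl rfl) rfl (Or.inl rfl)),
    fun s => AnyPath.costar_mk_eq_of_arrow_eq
      (hI.eq_of_length_eq_one h rfl (Or.inr rfl) rfl (Or.inr rfl))⟩

end Bigenerator

end IsAdmissible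

section UniqueArrows

variable [∀ a : V, Unique (Quiver.Star a)]

variable (I) in
/-- The sum of the classes of the arrows of a quiver with a unique arrow out of each vertex. -/
noncomputable def arrowSum : PathAlgebra K V ⧸ I :=
  ∑ a : V, cls I (AnyPath.arrow (default : Quiver.Star a).2)

theorem nil_mul_arrowSum {a b : V} (f : a ⟶ b) :
    cls I (AnyPath.nil a) * arrowSum I = cls I (AnyPath.arrow f) := by
  rw [arrowSum, Finset.mul_sum, Finset.sum_eq_single a
    (fun c _ hc => cls_mul_cls_of_ne (Ne.symm hc)) (by simp),
    ← Unique.eq_default (Quiver.Star.mk f)]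
  exact cls_nil_mul (AnyPath.arrow f)

theorem arrowSum_mul_nil [∀ a : V, Subsingleton (Costar a)] {a b : V} (f : a ⟶ b) :
    arrowSum I * cls I (AnyPath.nil b) = cls I (AnyPath.arrow f) := by
  have hne (c : V) (hc : c ≠ a) : (default : Quiver.Star c).1 ≠ b := by
    rintro rfl
    exact hc (congrArg Sigma.fst
      (Subsingleton.elim (Costar.mk (default : Quiver.Star c).2) (Costar.mk f)))
  rw [arrowSum, Finset.sum_mul, Finset.sum_eq_single a
    (fun c _ hc => cls_mul_cls_of_ne (hne c hc)) (by simp),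
    ← Unique.eq_default (Quiver.Star.mk f)]
  exact cls_mul_nil (AnyPath.arrow f)

theorem nil_mul_arrowSum_pow {a b : V} (p : Path a b) :
    cls I (AnyPath.nil a) * arrowSum I ^ p.length = cls I ⟨a, b, p⟩ := by
  induction p with
  | nil => rw [Path.length_nil, pow_zero, mul_one]
  | @cons b c p f ih =>
    rw [Path.length_cons, pow_succ, ← mul_assoc, ih, ← cls_mul_nil ⟨a, b, p⟩, mul_assoc,
      nil_mul_arrowSum f, cls_mul_cls]
    rfl

theorem exists_aeval_arrowSum (r : (PathAlgebra K V ⧸ I)ᵐᵒᵖ) (a : V) :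
    ∃ p : Polynomial K, r * MulOpposite.op (cls I (AnyPath.nil a)) =
      Polynomial.aeval (MulOpposite.op (arrowSum I)) p *
        MulOpposite.op (cls I (AnyPath.nil a)) := by
  let evalAt : Polynomial K →ₗ[K] (PathAlgebra K V ⧸ I)ᵐᵒᵖ :=
    LinearMap.mulRight K (MulOpposite.op (cls I (AnyPath.nil a))) ∘ₗ
      (Polynomial.aeval (MulOpposite.op (arrowSum I))).toLinearMap
  let opMul : PathAlgebra K V ⧸ I →ₗ[K] (PathAlgebra K V ⧸ I)ᵐᵒᵖ :=
    (MulOpposite.opLinearEquiv K).toLinearMap ∘ₗ LinearMap.mulLeft K (cls I (AnyPath.nil a))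
  suffices h : r.unop ∈ (LinearMap.range evalAt).comap opMul by
    obtain ⟨p, hp⟩ := h
    exact ⟨p, hp.symm⟩
  refine mem_of_cls_mem (fun s => ?_) _
  change MulOpposite.op (cls I (AnyPath.nil a) * cls I s) ∈ LinearMap.range evalAt
  obtain ⟨b, c, p⟩ := s
  by_cases h : a = b
  · subst h
    refine ⟨Polynomial.X ^ p.length, ?_⟩
    simp only [evalAt, LinearMap.comp_apply, LinearMap.mulRight_apply, AlgHom.toLinearMap_apply,
      map_pow, Polynomial.aeval_X]
    rw [← MulOpposite.op_pow, ← MulOpposite.op_mul, nil_mul_arrowSum_pow, cls_nil_mul ⟨a, c, p⟩]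
  · rw [cls_mul_cls_of_ne h, MulOpposite.op_zero]
    exact zero_mem _

variable [∀ a : V, Subsingleton (Costar a)]

/-- The cyclic system of right modules over an admissible quotient of the path algebra of a
disjoint union of oriented cycles. -/
noncomputable def IsAdmissible.cyclicSystem (hI : IsAdmissible I) :
    CyclicSystem K (PathAlgebra K V ⧸ I)ᵐᵒᵖ V where
  e a := MulOpposite.op (cls I (AnyPath.nil a))
  t := MulOpposite.op (arrowSum I)
  σ a := (default : Quiver.Star a).1
  complete :=
    have he := completeOrthogonalIdempotents_cls_nil (I := I)
    { idem := fun a => congrArg MulOpposite.op (he.idem a)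
      ortho := fun _ _ h => congrArg MulOpposite.op (he.ortho h.symm)
      complete := (Finset.op_sum _ _).symm.trans (congrArg MulOpposite.op he.complete) }
  t_mul_e a := by
    rw [← MulOpposite.op_mul, ← MulOpposite.op_mul, nil_mul_arrowSum (default : Quiver.Star a).2,
      arrowSum_mul_nil (default : Quiver.Star a).2]
  exists_aeval := exists_aeval_arrowSum
  isNilpotent_t := by
    have hrad : arrowSum I ∈ hI.vertexSystem.rad :=
      sum_mem fun a _ => hI.cls_mem_rad (s := AnyPath.arrow (default : Quiver.Star a).2) one_pos
    obtain ⟨n, hn⟩ := hI.vertexSystem.isNilpotent _ (hI.vertexSystem.mem_rad.1 hrad)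
    exact ⟨n, by rw [← MulOpposite.op_pow, hn, MulOpposite.op_zero]⟩

end UniqueArrows

end PathAlgebra

theorem forall_of_weaklyConnected {V : Type*} [Quiver V]
    (hconn : Subsingleton (Quiver.WeaklyConnectedComponent V)) {P : V → Prop}
    (hP : ∀ {a b : V}, (a ⟶ b) → (P a ↔ P b)) {i : V} (hi : P i) (a : V) : P a := by
  obtain ⟨p⟩ := (Quiver.WeaklyConnectedComponent.eq i a).1 (Subsingleton.elim _ _)
  induction p with
  | nil => exact hi
  | cons _ f ih =>
    rcases f with f | f
    · exact (hP f).1 ih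
    · exact (hP f).2 ih

theorem eq_or_eq_of_two_cycle {V : Type*} [Quiver V]
    (hconn : Subsingleton (Quiver.WeaklyConnectedComponent V)) {i j : V} {α : i ⟶ j} {γ : j ⟶ i}
    (hi : ∀ s : Quiver.Star i, s = Quiver.Star.mk α)
    (hj : ∀ s : Quiver.Costar j, s = Quiver.Costar.mk α)
    (hj' : ∀ s : Quiver.Star j, s = Quiver.Star.mk γ)
    (hi' : ∀ s : Quiver.Costar i, s = Quiver.Costar.mk γ) (a : V) : a = i ∨ a = j := by
  refine forall_of_weaklyConnected hconn (P := fun a => a = i ∨ a = j) (fun {b c} f => ?_)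
    (Or.inl rfl) a
  constructor
  · rintro (rfl | rfl)
    · exact Or.inr (congrArg Sigma.fst (hi (Quiver.Star.mk f)))
    · exact Or.inl (congrArg Sigma.fst (hj' (Quiver.Star.mk f)))
  · rintro (rfl | rfl)
    · exact Or.inr (congrArg Sigma.fst (hi' (Quiver.Costar.mk f)))
    · exact Or.inl (congrArg Sigma.fst (hj (Quiver.Costar.mk f)))

theorem lemma2p1_general {K : Type u} [Field K]
    {V : Type v} [Fintype V] [DecidableEq V] [Quiver.{w} V] [∀ a b : V, Finite (a ⟶ b)]
    (hconn : Subsingleton (Quiver.WeaklyConnectedComponent V))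
    (I : Ideal (PathAlgebra K V)) [I.IsTwoSided] (hI : PathAlgebra.IsAdmissible I)
    (hsymm : IsSymmetricAlgebraOver K (PathAlgebra K V ⧸ I))
    (hper : IsIteratedSyzygy (regularBimodule K (PathAlgebra K V ⧸ I)) 4
      (regularBimodule K (PathAlgebra K V ⧸ I)))
    {i j : V} (α : i ⟶ j) (hi : ∀ s : Quiver.Star i, s = Quiver.Star.mk α)
    (hj : ∀ s : Quiver.Costar j, s = Quiver.Costar.mk α) :
    IsFiniteRepType (PathAlgebra K V ⧸ I) := by
  have := hI.finiteDimensional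
  obtain ⟨β, hβ⟩ := (hI.isBigenerator α hi hj).exists_symm hsymm (hper.quotient_ker_character _)
  obtain ⟨γ, hj', hi'⟩ := hI.exists_unique_arrow hβ
  have hV := eq_or_eq_of_two_cycle hconn hi hj hj' hi'
  have hstar (a : V) : Nonempty (Unique (Quiver.Star a)) := by
    rcases hV a with rfl | rfl
    exacts [⟨⟨⟨_⟩, hi⟩⟩, ⟨⟨⟨_⟩, hj'⟩⟩]
  have hcostar (a : V) : Subsingleton (Quiver.Costar a) := by
    rcases hV a with rfl | rfl
    exacts [⟨fun s t => (hi' s).trans (hi' t).symm⟩, ⟨fun s t => (hj s).trans (hj t).symm⟩]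
  have (a : V) : Unique (Quiver.Star a) := (hstar a).some
  exact hI.cyclicSystem.isFiniteRepType

theorem lemma2p1 {K : Type u} [Field K] [IsAlgClosed K]
    {V : Type v} [Fintype V] [DecidableEq V] [Quiver.{w} V] [∀ a b : V, Finite (a ⟶ b)]
    -- the quiver is connected
    (hconn : Subsingleton (Quiver.WeaklyConnectedComponent V))
    -- at most two arrows start and at most two arrows end at each vertex
    (hout : ∀ i : V, Nat.card (Quiver.Star i) ≤ 2)
    (hin : ∀ i : V, Nat.card (Quiver.Costar i) ≤ 2)
    (I : Ideal (PathAlgebra K V)) [I.IsTwoSided] (hI : PathAlgebra.IsAdmissible I)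
    (htame : IsTame K (PathAlgebra K V ⧸ I))
    (hsymm : IsSymmetricAlgebraOver K (PathAlgebra K V ⧸ I))
    (hper : IsPeriodicAlgebra K (PathAlgebra K V ⧸ I) 4)
    (hinf : ¬ IsFiniteRepType (PathAlgebra K V ⧸ I)) :
    ¬ ∃ (i j : V) (α : i ⟶ j),
      (Set.univ : Set (Quiver.Star i)) = {Quiver.Star.mk α} ∧
      (Set.univ : Set (Quiver.Costar j)) = {Quiver.Costar.mk α} := by
  rintro ⟨i, j, α, hi, hj⟩
  exact hinf (lemma2p1_general hconn I hI hsymm hper.1.2 α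
    (Set.eq_univ_iff_forall.1 hi.symm) (Set.eq_univ_iff_forall.1 hj.symm))
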